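/- For $s\ge 0$ let $H^s_{per}=H^s_{per}([-\pi,\pi])$ be the space of real-valued $2\pi$-periodic functions $f\in L^2$ with $$\|f\|_{H^s_{per}}^2=2\pi\sum_{k\in\mathbb Z}(1+|k|^2)^s|\widehat f(k)|^2<\infty,\qquad \widehat f(k)=\frac1{2\pi}\int_{-\pi}^{\pi}f(x)e^{-ikx}\,dx,$$ and let $\mathcal H$ be the periodic Hilbert transform, $\widehat{\mathcal Hf}(k)=-i\,\mathrm{sgn}(k)\widehat f(k)$ (with $\mathrm{sgn}(0)=0$). Consider the periodic initial value problem for the regularized Benjamin–Ono (rBO) equation $$u_t+u_x+uu_x+\mathcal Hu_{xt}=0,\qquad u(\cdot,0)=u_0. \tag{1}$$ For an interval $I\ni 0$, a solution of (1) on $I$ in $H^s_{per}$ is a function $u\in C(I;H^s_{per})$ with $u(0)=u_0$ that satisfies the equation, with $uu_x=\partial_x(u^2/2)$, at every $t\in I$ in the sense of periodic distributions (i.e. in every Fourier coefficient). Let $s\ge 3/2$. Then: (a) (A priori estimate.) There are constants $C=C(\|u_0\|_{H^{3/2}_{per}})>0$ and $C_s=C_s(\|u_0\|_{H^s_{per}})>0$,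 that is, positive functions of these norms which may also depend on $s$ but not on $T$ or $u$, such that for every $T>0$, every $u_0\in H^s_{per}$ and every solution $u\in C([0,T];H^s_{per})$ of (1) on $[0,T]$, $$\sup_{t\in[0,T]}\|u(t)\|_{H^s_{per}}\le C_s\,e^{CT}.$$ (b) (Global well-posedness.) Problem (1) is globally well-posed in $H^s_{per}$: for every $u_0\in H^s_{per}$ there is a solution $u\in C(\mathbb R;H^s_{per})$ of (1) on $\mathbb R$; on every interval containing $0$ it is the only solution of (1) in $H^s_{per}$; and for every $u_0\in H^s_{per}$ and every $T>0$ there is a neighbourhood $V$ of $u_0$ in $H^s_{per}$ on which the map from initial data to solutions, $V\to C([-T,T];H^s_{per})$, is Lipschitz (in particular continuous). -/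

import Mathlib

open MeasureTheory Set Topology

noncomputable section

namespace RBO

/-- The period `2π` is positive. -/
instance factTwoPi : Fact (0 < 2 * Real.pi) := ⟨Real.two_pi_pos⟩

/-- The circle `ℝ / 2πℤ`; functions on it are the `2π`-periodic functions on `ℝ`. -/
abbrev Circ : Type := AddCircle (2 * Real.pi)

/-- Real-valued, `2π`-periodic, square integrable functions (modulo null sets). The normalization
of the Haar measure plays no role: the norm of `L2per` is not used below. -/
abbrev L2per : Type := Lp ℝ 2 (AddCircle.haarAddCircle : Measure Circ)

/-- Fourier coefficients of a real-valued periodic function,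
`(1 / 2π) ∫_{-π}^{π} f(x) exp(-ikx) dx`. -/
def coeff (f : Circ → ℝ) (k : ℤ) : ℂ := fourierCoeff (fun x => (f x : ℂ)) k

lemma coeff_eq_integral (f : Circ → ℝ) (k : ℤ) :
    coeff f k = (1 / (2 * Real.pi) : ℝ) •
      ∫ x in (-Real.pi)..Real.pi, Complex.exp (-(Complex.I * k * x)) * (f (x : Circ) : ℂ) := by
  rw [coeff, fourierCoeff_eq_intervalIntegral _ _ (-Real.pi)]
  have h : -Real.pi + 2 * Real.pi = Real.pi := by ring
  rw [h]
  congr 1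
  refine intervalIntegral.integral_congr fun x _ => ?_
  simp only [fourier_coe_apply, smul_eq_mul]
  congr 2
  have : (Real.pi : ℂ) ≠ 0 := by exact_mod_cast Real.pi_ne_zero
  push_cast
  field_simp

lemma integrable_coe (f : L2per) :
    Integrable (fun x => (f x : ℂ)) (AddCircle.haarAddCircle : Measure Circ) :=
  ((Lp.memLp f).integrable one_le_two).ofReal

lemma coeff_add (f g : L2per) (k : ℤ) :
    coeff (f + g : L2per) k = coeff f k + coeff g k := by
  unfold coeff
  rw [fourierCoeff_congr_ae (g := (fun x => (f x : ℂ)) + fun x => (g x : ℂ))]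
  · exact congrFun (fourierCoeff.add (integrable_coe f) (integrable_coe g)) k
  · filter_upwards [Lp.coeFn_add f g] with x hx
    rw [hx]
    simp only [Pi.add_apply]
    push_cast
    rfl

lemma coeff_smul (c : ℝ) (f : L2per) (k : ℤ) :
    coeff (c • f : L2per) k = (c : ℂ) * coeff f k := by
  unfold coeff
  rw [fourierCoeff_congr_ae (g := fun x => (c : ℂ) * (f x : ℂ))]
  · exact fourierCoeff.const_mul _ _ _
  · filter_upwards [Lp.coeFn_smul c f] with x hx
    rw [hx]
    simp only [Pi.smul_apply, smul_eq_mul]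
    push_cast
    rfl

lemma coeff_zero (k : ℤ) : coeff (0 : L2per) k = 0 := by
  simpa using coeff_smul 0 (0 : L2per) k

/-- A square integrable function is determined by its Fourier coefficients. -/
lemma eq_zero_of_coeff (f : L2per) (h : ∀ k, coeff f k = 0) : f = 0 := by
  have hm : MemLp (fun x => (f x : ℂ)) 2 (AddCircle.haarAddCircle : Measure Circ) :=
    (Lp.memLp f).ofReal
  have hz : hm.toLp _ = 0 := by
    refine (fourierBasis (T := 2 * Real.pi)).repr.map_eq_zero_iff.1 ?_
    ext k
    rw [fourierBasis_repr, fourierCoeff_congr_ae hm.coeFn_toLp]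
    exact h k
  have hz' := (Lp.eq_zero_iff_ae_eq_zero).1 hz
  refine (Lp.eq_zero_iff_ae_eq_zero).2 ?_
  filter_upwards [hz', hm.coeFn_toLp] with x hx hx'
  rw [hx'] at hx
  exact Complex.ofReal_eq_zero.1 hx

/-- The sequence `(1 + k²)^(s/2) f̂(k)`. -/
def weighted (s : ℝ) (f : Circ → ℝ) (k : ℤ) : ℂ :=
  (((1 + (k : ℝ) ^ 2) ^ (s / 2) : ℝ) : ℂ) * coeff f k

lemma norm_weighted_sq (s : ℝ) (f : Circ → ℝ) (k : ℤ) :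
    ‖weighted s f k‖ ^ 2 = (1 + (k : ℝ) ^ 2) ^ s * ‖coeff f k‖ ^ 2 := by
  have h : (0 : ℝ) ≤ 1 + (k : ℝ) ^ 2 := by positivity
  rw [weighted, norm_mul, mul_pow, Complex.norm_real, Real.norm_eq_abs, sq_abs,
    ← Real.rpow_natCast, ← Real.rpow_mul h]
  norm_num

/-- Membership in the periodic Sobolev space of order `s ≥ 0`:
`∑ₖ (1 + k²)^s |f̂(k)|² < ∞`. -/
def MemHs (s : ℝ) (f : Circ → ℝ) : Prop :=
  Summable fun k : ℤ => (1 + (k : ℝ) ^ 2) ^ s * ‖coeff f k‖ ^ 2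

/-- The Sobolev norm `(2π ∑ₖ (1 + k²)^s |f̂(k)|²)^(1/2)`. -/
def hsNorm (s : ℝ) (f : Circ → ℝ) : ℝ :=
  Real.sqrt (2 * Real.pi * ∑' k : ℤ, (1 + (k : ℝ) ^ 2) ^ s * ‖coeff f k‖ ^ 2)

lemma memHs_iff (s : ℝ) (f : Circ → ℝ) :
    MemHs s f ↔ Memℓp (weighted s f) 2 := by
  rw [memℓp_gen_iff (by norm_num)]
  simp [MemHs, ← norm_weighted_sq]

lemma weighted_add (s : ℝ) (f g : L2per) :
    weighted s (f + g : L2per) = weighted s f + weighted s g := by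
  ext k; simp only [weighted, coeff_add, Pi.add_apply, mul_add]

lemma weighted_smul (s c : ℝ) (f : L2per) :
    weighted s (c • f : L2per) = (c : ℂ) • weighted s f := by
  ext k; simp only [weighted, coeff_smul, Pi.smul_apply, smul_eq_mul]; ring

/-- The periodic Sobolev space of order `s ≥ 0` as a real subspace of `L2per`. -/
def hsSubmodule (s : ℝ) : Submodule ℝ L2per where
  carrier := {f | MemHs s f}
  zero_mem' := by
    simp only [mem_ofPred_eq, MemHs, coeff_zero]
    simp
  add_mem' := by
    intro f g hf hg
    simp only [mem_ofPred_eq, memHs_iff] at *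
    rw [weighted_add]; exact hf.add hg
  smul_mem' := by
    intro c f hf
    simp only [mem_ofPred_eq, memHs_iff] at *
    rw [weighted_smul]; exact hf.const_smul _

/-- The space `H^s_per([-π, π])` (`s ≥ 0`) of real-valued functions, to be equipped with the
Sobolev norm `hsNorm s` (and not with the `L²` norm). -/
def Hs (s : ℝ) : Type := hsSubmodule s

instance (s : ℝ) : AddCommGroup (Hs s) := inferInstanceAs (AddCommGroup (hsSubmodule s))

instance (s : ℝ) : Module ℝ (Hs s) := inferInstanceAs (Module ℝ (hsSubmodule s))

/-- The square integrable function underlying an element of `H^s_per`. -/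
def Hs.fn {s : ℝ} (f : Hs s) : L2per := f.1

instance (s : ℝ) : Norm (Hs s) := ⟨fun f => hsNorm s f.fn⟩

lemma Hs.norm_def {s : ℝ} (f : Hs s) : ‖f‖ = hsNorm s f.fn := rfl

/-- The weighted Fourier coefficients of an element of `H^s_per`, in `ℓ²(ℤ)`. -/
def Hs.toSeq {s : ℝ} (f : Hs s) : lp (fun _ : ℤ => ℂ) 2 :=
  ⟨weighted s f.fn, (memHs_iff s f.fn).1 f.2⟩

lemma Hs.norm_eq {s : ℝ} (f : Hs s) : ‖f‖ = Real.sqrt (2 * Real.pi) * ‖f.toSeq‖ := by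
  have h : ‖f.toSeq‖ ^ 2 = ∑' k : ℤ, (1 + (k : ℝ) ^ 2) ^ s * ‖coeff f.fn k‖ ^ 2 := by
    have := lp.norm_rpow_eq_tsum (p := 2) (by norm_num) f.toSeq
    simp only [ENNReal.toReal_ofNat, Real.rpow_two] at this
    rw [this]
    exact tsum_congr fun k => norm_weighted_sq s f.fn k
  rw [Hs.norm_def, hsNorm, ← h, Real.sqrt_mul Real.two_pi_pos.le, Real.sqrt_sq (norm_nonneg _)]

lemma Hs.toSeq_add {s : ℝ} (f g : Hs s) : (f + g).toSeq = f.toSeq + g.toSeq :=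
  Subtype.ext (weighted_add s f.fn g.fn)

lemma Hs.toSeq_smul {s : ℝ} (c : ℝ) (f : Hs s) : (c • f).toSeq = (c : ℂ) • f.toSeq :=
  Subtype.ext (weighted_smul s c f.fn)

lemma Hs.eq_zero_of_toSeq {s : ℝ} (f : Hs s) (h : f.toSeq = 0) : f = 0 := by
  apply Subtype.ext
  refine eq_zero_of_coeff f.fn fun k => ?_
  have h1 : weighted s f.fn k = 0 := congrFun (congrArg Subtype.val h) k
  have h2 : (0 : ℝ) < 1 + (k : ℝ) ^ 2 := by positivity
  rw [weighted, mul_eq_zero] at h1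
  rcases h1 with h1 | h1
  · exact absurd (by exact_mod_cast h1) (Real.rpow_pos_of_pos h2 (s / 2)).ne'
  · exact h1

lemma Hs.core (s : ℝ) : NormedSpace.Core ℝ (Hs s) where
  norm_nonneg f := Real.sqrt_nonneg _
  norm_smul c f := by
    rw [Hs.norm_eq, Hs.norm_eq, Hs.toSeq_smul, norm_smul, Complex.norm_real]; ring
  norm_triangle f g := by
    rw [Hs.norm_eq, Hs.norm_eq, Hs.norm_eq, Hs.toSeq_add, ← mul_add]
    exact mul_le_mul_of_nonneg_left (norm_add_le _ _) (Real.sqrt_nonneg _)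
  norm_eq_zero_iff f := by
    have hp : Real.sqrt (2 * Real.pi) ≠ 0 := (Real.sqrt_pos.2 Real.two_pi_pos).ne'
    constructor
    · intro h
      rw [Hs.norm_eq, mul_eq_zero, norm_eq_zero] at h
      exact f.eq_zero_of_toSeq (h.resolve_left hp)
    · rintro rfl
      have : (0 : Hs s).toSeq = 0 := by
        simpa using Hs.toSeq_smul 0 (0 : Hs s)
      rw [Hs.norm_eq, this, norm_zero, mul_zero]

instance (s : ℝ) : NormedAddCommGroup (Hs s) := NormedAddCommGroup.ofCore (Hs.core s)

instance (s : ℝ) : NormedSpace ℝ (Hs s) := NormedSpace.ofCore (Hs.core s)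

/-- `∂ₓ` on the Fourier side, for sequences of Fourier coefficients of periodic distributions. -/
def dx (a : ℤ → ℂ) (k : ℤ) : ℂ := Complex.I * k * a k

/-- The Hilbert transform on the Fourier side. -/
def hilbert (a : ℤ → ℂ) (k : ℤ) : ℂ := -Complex.I * (Int.sign k : ℂ) * a k

/-- `u` is a solution in `C(I; H^s_per)`, on the time set `I`, of the problem
`u_t + u_x + u u_x + 𝓗 u_{xt} = 0`, `u(0) = u₀`. The equation is understood in the sense of periodic
distributions, that is, in every Fourier coefficient, with `u u_x = ∂ₓ (u² / 2)`; `ut` is the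
sequence of Fourier coefficients of `u_t(t)`. -/
structure IsSolution (s : ℝ) (I : Set ℝ) (u₀ : Hs s) (u : ℝ → Hs s) : Prop where
  continuousOn : ContinuousOn u I
  initial : u 0 = u₀
  equation : ∀ t ∈ I, ∃ ut : ℤ → ℂ,
    (∀ k, HasDerivWithinAt (fun τ => coeff (u τ).fn k) (ut k) I t) ∧
    ∀ k, ut k + dx (coeff (u t).fn) k + dx (coeff fun x => ((u t).fn x) ^ 2 / 2) k
      + hilbert (dx ut) k = 0

/-- Global well-posedness in `H^s_per`: there is a flow map `S`, defined for all initial data and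
all times, such that `S u₀` is a solution on `ℝ`, it is the only solution on every interval that
contains `0`, and on every bounded time interval the data-to-solution map is locally Lipschitz
(in particular continuous) from `H^s_per` to `C([-T, T]; H^s_per)`. -/
def GloballyWellPosed (s : ℝ) : Prop :=
  ∃ S : Hs s → ℝ → Hs s,
    (∀ u₀, IsSolution s univ u₀ (S u₀)) ∧
    (∀ (I : Set ℝ), I.OrdConnected → (0 : ℝ) ∈ I → ∀ (u₀ : Hs s) (u : ℝ → Hs s),
      IsSolution s I u₀ u → EqOn u (S u₀) I) ∧
    (∀ (u₀ : Hs s) (T : ℝ), 0 < T → ∃ V ∈ 𝓝 u₀, ∃ K : ℝ, ∀ v ∈ V, ∀ w ∈ V,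
      ∀ t ∈ Icc (-T) T, ‖S v t - S w t‖ ≤ K * ‖v - w‖)

end RBO

end

/-! On the Fourier side `𝓗 ∂ₓ` is multiplication by `|k|`, so the equation solved for the time
derivative reads `û_t(k) = θ(k) (û + (u²/2)^)(k)` with `θ(k) = -ik / (1 + |k|)` bounded. For the
weighted coefficients `b k = (1 + k²)^(s/2) û(k)` this is an ordinary differential equation `b' =
field b` in `ℓ²(ℤ)`. Its right-hand side is a bounded linear map plus a bounded quadratic one,
because `H^s` is an algebra; hence it is locally Lipschitz, and uniqueness and Lipschitz dependence
follow from Gronwall once solutions are bounded.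

The bound comes from energy identities. The derivative of a diagonal quadratic energy is a cubic
form `∑ ν(a + c) û(a) û(c) û(-(a + c))` with `ν` odd. Averaging over the three frequencies `a + c +
e = 0` replaces its symbol by `ν(a) + ν(c) + ν(e)`, up to a factor `-1/3`. For the weight `1 + |k|`
one has `ν(k) = k`, the symbol vanishes, and `∑ (1 + |k|) |û(k)|²` is conserved. For the `H^s` norm
the symbol is controlled by the smallest frequency `a` (`abs_sym_add_le`), in the form `|a| (1 +
e²)^(s/2) (1 + c²)^((s-1)/2)`. The inequality `xy ≤ x² + y²` then splits the form into two pieces: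
one is at most the conserved energy times `‖b‖²`, the other contains `∑ |a| / (1 + c²)` over `|a| ≤
|c|`, which is at most `3`. So `‖b‖²` grows at a rate fixed by the conserved energy
(`abs_inner_field_le`), and no logarithmic loss occurs.

Global existence uses a truncated, globally Lipschitz field. Its trajectories solve `b' = χ(t) field
b` with `0 ≤ χ ≤ 1`; the same a priori bound holds for them, so the truncation is never felt. A
solution in the sense of Fourier coefficients is differentiable in `ℓ²`
(`hasDerivWithinAt_of_coord`), so all statements transfer to it. -/

noncomputable section

namespace RBO

/-! ### Fourier coefficients of real functions and of their squares. -/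

open ComplexConjugate in
lemma fourierCoeff_conj (f : Circ → ℂ) (k : ℤ) :
    fourierCoeff (fun x => conj (f x)) k = conj (fourierCoeff f (-k)) := by
  simp only [fourierCoeff, ← integral_conj, smul_eq_mul, map_mul, neg_neg, fourier_neg]

open ComplexConjugate in
lemma coeff_neg (f : Circ → ℝ) (k : ℤ) : coeff f (-k) = conj (coeff f k) := by
  have h := fourierCoeff_conj (fun x => (f x : ℂ)) (-k)
  simpa [coeff] using h

open ComplexConjugate in
/-- Every square summable sequence with the symmetry of a real function is the sequence of Fourier
coefficients of a real-valued square integrable function. -/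
lemma exists_coeff_eq (c : ℤ → ℂ) (hc : Memℓp c 2) (hsymm : ∀ k, c (-k) = conj (c k)) :
    ∃ f : L2per, ∀ k, coeff f k = c k := by
  set φ : Lp ℂ 2 (AddCircle.haarAddCircle : Measure Circ) :=
    fourierBasis.repr.symm (⟨c, hc⟩ : lp (fun _ : ℤ => ℂ) 2) with hφ
  have hφc : ∀ k, fourierCoeff φ k = c k := fun k => by
    rw [← fourierBasis_repr, hφ, LinearIsometryEquiv.apply_symm_apply]
  have hi : Integrable φ (AddCircle.haarAddCircle : Measure Circ) :=
    (Lp.memLp φ).integrable one_le_two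
  have hi' : Integrable (fun x => conj (φ x)) (AddCircle.haarAddCircle : Measure Circ) :=
    (Lp.memLp φ).star.integrable one_le_two
  have hre : MemLp (fun x => (φ x).re) 2 (AddCircle.haarAddCircle : Measure Circ) :=
    (Lp.memLp φ).re
  refine ⟨hre.toLp _, fun k => ?_⟩
  have h1 : coeff (hre.toLp _) k =
      fourierCoeff (fun x => (1 / 2 : ℂ) * ((φ : Circ → ℂ) + fun x => conj (φ x)) x) k := by
    unfold coeff
    rw [fourierCoeff_congr_ae]
    filter_upwards [hre.coeFn_toLp] with x hx
    rw [hx, Pi.add_apply, Complex.add_conj]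
    push_cast
    ring
  rw [h1, fourierCoeff.const_mul, fourierCoeff.add hi hi', Pi.add_apply, fourierCoeff_conj,
    hφc, hφc, hsymm, Complex.conj_conj]
  ring

/-- Parseval's identity for the inner product of `e_k f` with `f`, where `e_k` is the `k`-th
exponential; square integrability of `f` suffices. -/
lemma hasSum_coeff_sq (f : L2per) (k : ℤ) :
    HasSum (fun j => coeff f j * coeff f (k - j)) (coeff (fun x => f x ^ 2) k) := by
  have hm : MemLp (fun x => (f x : ℂ)) 2 (AddCircle.haarAddCircle : Measure Circ) :=
    (Lp.memLp f).ofReal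
  have hm' : MemLp (fun x => fourier k x * (f x : ℂ)) 2
      (AddCircle.haarAddCircle : Measure Circ) := by
    refine hm.of_le ((fourier k).continuous.aestronglyMeasurable.mul hm.1) ?_
    filter_upwards with x
    rw [norm_mul, fourier_apply, Circle.norm_coe, one_mul]
  have h := (fourierBasis (T := 2 * Real.pi)).hasSum_inner_mul_inner (hm'.toLp _) (hm.toLp _)
  have e1 : ∀ j, inner ℂ (fourierBasis (T := 2 * Real.pi) j) (hm.toLp _) = coeff f j := by
    intro j
    rw [← HilbertBasis.repr_apply_apply, fourierBasis_repr, fourierCoeff_congr_ae hm.coeFn_toLp]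
    rfl
  have e2 : ∀ j, inner ℂ (hm'.toLp _) (fourierBasis (T := 2 * Real.pi) j) =
      coeff f (k - j) := by
    intro j
    rw [← inner_conj_symm, ← HilbertBasis.repr_apply_apply, fourierBasis_repr,
      fourierCoeff_congr_ae hm'.coeFn_toLp]
    have : k - j = -(j - k) := by ring
    rw [this, coeff_neg]
    congr 1
    simp only [coeff, fourierCoeff, smul_eq_mul, ← mul_assoc]
    congr 1
    ext x
    rw [← fourier_add]
    congr 3
    ring
  have e3 : inner ℂ (hm'.toLp _) (hm.toLp _) = coeff (fun x => f x ^ 2) k := by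
    rw [L2.inner_def]
    unfold coeff fourierCoeff
    refine integral_congr_ae ?_
    filter_upwards [hm.coeFn_toLp, hm'.coeFn_toLp] with x hx hx'
    rw [hx, hx']
    simp only [RCLike.inner_apply, map_mul, Complex.conj_ofReal, smul_eq_mul, fourier_neg]
    push_cast
    ring
  rw [e3] at h
  simp only [e1, e2] at h
  simpa only [mul_comm] using h

lemma coeff_sq_div_two (f : L2per) (k : ℤ) :
    coeff (fun x => f x ^ 2 / 2) k = 1 / 2 * ∑' j, coeff f j * coeff f (k - j) := by
  rw [(hasSum_coeff_sq f k).tsum_eq]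
  unfold coeff
  rw [← fourierCoeff.const_mul]
  congr 1
  ext x
  push_cast
  ring

/-! ### Bounded bilinear and diagonal operators on `ℓ²`. -/

/-- Square summable complex sequences on `ℤ`. -/
abbrev SeqL2 : Type := lp (fun _ : ℤ => ℂ) 2

lemma SeqL2.hasSum_norm_sq (b : SeqL2) : HasSum (fun k => ‖b k‖ ^ 2) (‖b‖ ^ 2) := by
  have := lp.hasSum_norm (p := 2) (by norm_num) b
  simpa only [ENNReal.toReal_ofNat, Real.rpow_two] using this

lemma SeqL2.summable_norm_sq (b : SeqL2) : Summable fun k => ‖b k‖ ^ 2 := b.hasSum_norm_sq.summable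

lemma SeqL2.tsum_norm_sq (b : SeqL2) : ∑' k, ‖b k‖ ^ 2 = ‖b‖ ^ 2 := b.hasSum_norm_sq.tsum_eq

lemma memlp_two_iff (b : ℤ → ℂ) : Memℓp b 2 ↔ Summable fun k => ‖b k‖ ^ 2 := by
  rw [memℓp_gen_iff (by norm_num)]
  simp

/-- The Cauchy–Schwarz inequality for series of nonnegative numbers. -/
lemma summable_mul_and_tsum_mul_sq_le {ι : Type*} {f g : ι → ℝ} (hf : ∀ i, 0 ≤ f i)
    (hg : ∀ i, 0 ≤ g i) (hfs : Summable fun i => f i ^ 2) (hgs : Summable fun i => g i ^ 2) :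
    (Summable fun i => f i * g i) ∧
      (∑' i, f i * g i) ^ 2 ≤ (∑' i, f i ^ 2) * ∑' i, g i ^ 2 := by
  have h := Real.summable_and_inner_le_Lp_mul_Lq_tsum_of_nonneg (p := 2) (q := 2)
    (by constructor <;> norm_num) hf hg (by simpa using hfs) (by simpa using hgs)
  refine ⟨h.1, ?_⟩
  have h2 := h.2
  simp only [Real.rpow_two, ← Real.sqrt_eq_rpow] at h2
  have h0 : 0 ≤ ∑' i, f i * g i := tsum_nonneg fun i => mul_nonneg (hf i) (hg i)
  calc (∑' i, f i * g i) ^ 2 ≤ (√(∑' i, f i ^ 2) * √(∑' i, g i ^ 2)) ^ 2 := by gcongr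
    _ = _ := by
      rw [mul_pow, Real.sq_sqrt (tsum_nonneg fun i => sq_nonneg _),
        Real.sq_sqrt (tsum_nonneg fun i => sq_nonneg _)]

/-- The bijection `(k, j) ↦ (j, k - j)` of `ℤ × ℤ`. -/
def convEquiv : ℤ × ℤ ≃ ℤ × ℤ where
  toFun p := (p.2, p.1 - p.2)
  invFun p := (p.1 + p.2, p.1)
  left_inv p := by ext <;> simp
  right_inv p := by ext <;> simp

lemma hasSum_conv_sq (b c : SeqL2) :
    HasSum (fun p : ℤ × ℤ => ‖b p.2‖ ^ 2 * ‖c (p.1 - p.2)‖ ^ 2) (‖b‖ ^ 2 * ‖c‖ ^ 2) := by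
  have h := b.hasSum_norm_sq.mul c.hasSum_norm_sq (b.summable_norm_sq.mul_of_nonneg
    c.summable_norm_sq (fun _ => sq_nonneg _) (fun _ => sq_nonneg _))
  exact (convEquiv.hasSum_iff (f := fun p : ℤ × ℤ => ‖b p.1‖ ^ 2 * ‖c p.2‖ ^ 2)).2 h

/-- Kernels `κ k j` whose rows are bounded in `ℓ²`. -/
structure RowBounded (κ : ℤ → ℤ → ℂ) (M : ℝ) : Prop where
  summable : ∀ k, Summable fun j => ‖κ k j‖ ^ 2
  tsum_le : ∀ k, ∑' j, ‖κ k j‖ ^ 2 ≤ M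

/-- The bilinear expression `∑ⱼ κ k j b j c (k - j)`. -/
def kerSum (κ : ℤ → ℤ → ℂ) (b c : ℤ → ℂ) (k : ℤ) : ℂ := ∑' j, κ k j * (b j * c (k - j))

namespace RowBounded

variable {κ : ℤ → ℤ → ℂ} {M : ℝ} (hκ : RowBounded κ M)
include hκ
lemma nonneg : 0 ≤ M := (tsum_nonneg fun _ => sq_nonneg _).trans (hκ.tsum_le 0)

lemma summable_norm (b c : SeqL2) (k : ℤ) : Summable fun j => ‖κ k j * (b j * c (k - j))‖ := by
  have h := (summable_mul_and_tsum_mul_sq_le (f := fun j => ‖κ k j‖)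
    (g := fun j => ‖b j * c (k - j)‖) (fun _ => norm_nonneg _) (fun _ => norm_nonneg _)
    (hκ.summable k)
    (by simpa [mul_pow] using (hasSum_conv_sq b c).summable.prod_factor k)).1
  simpa using h

lemma summable' (b c : SeqL2) (k : ℤ) : Summable fun j => κ k j * (b j * c (k - j)) :=
  (hκ.summable_norm b c k).of_norm

/-- Cauchy–Schwarz in `j`, with the kernel row as one factor. The right side sums over `k` to `M
‖b‖² ‖c‖²`. -/
lemma norm_kerSum_sq_le (b c : SeqL2) (k : ℤ) :
    ‖kerSum κ b c k‖ ^ 2 ≤ M * ∑' j, ‖b j‖ ^ 2 * ‖c (k - j)‖ ^ 2 := by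
  have h := (summable_mul_and_tsum_mul_sq_le (f := fun j => ‖κ k j‖)
    (g := fun j => ‖b j * c (k - j)‖) (fun _ => norm_nonneg _) (fun _ => norm_nonneg _)
    (hκ.summable k)
    (by simpa [mul_pow] using (hasSum_conv_sq b c).summable.prod_factor k)).2
  have h1 : ‖kerSum κ b c k‖ ≤ ∑' j, ‖κ k j‖ * ‖b j * c (k - j)‖ := by
    simpa [kerSum] using norm_tsum_le_tsum_norm (hκ.summable_norm b c k)
  calc ‖kerSum κ b c k‖ ^ 2 ≤ (∑' j, ‖κ k j‖ * ‖b j * c (k - j)‖) ^ 2 := by gcongr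
    _ ≤ _ := h
    _ ≤ M * ∑' j, ‖b j * c (k - j)‖ ^ 2 := by
      exact mul_le_mul_of_nonneg_right (hκ.tsum_le k) (tsum_nonneg fun _ => sq_nonneg _)
    _ = _ := by simp [mul_pow]

lemma summable_kerSum_sq (b c : SeqL2) : Summable fun k => ‖kerSum κ b c k‖ ^ 2 :=
  .of_nonneg_of_le (fun _ => sq_nonneg _) (hκ.norm_kerSum_sq_le b c)
    ((hasSum_conv_sq b c).summable.prod.mul_left M)

/-- `kerSum κ b c` as an element of `ℓ²`. -/
def kerSeq (b c : SeqL2) : SeqL2 :=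
  ⟨kerSum κ b c, (memlp_two_iff _).2 (hκ.summable_kerSum_sq b c)⟩

lemma norm_kerSeq_le (b c : SeqL2) : ‖hκ.kerSeq b c‖ ≤ √M * ‖b‖ * ‖c‖ := by
  have h : ‖hκ.kerSeq b c‖ ^ 2 ≤ (√M * ‖b‖ * ‖c‖) ^ 2 := by
    rw [← SeqL2.tsum_norm_sq, mul_assoc, mul_pow, Real.sq_sqrt hκ.nonneg, mul_pow,
      ← (hasSum_conv_sq b c).tsum_eq, (hasSum_conv_sq b c).summable.tsum_prod, ← tsum_mul_left]
    exact (hκ.summable_kerSum_sq b c).tsum_le_tsum (hκ.norm_kerSum_sq_le b c)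
      ((hasSum_conv_sq b c).summable.prod.mul_left M)
  exact abs_le_of_sq_le_sq' h (by positivity) |>.2

/-- `kerSum κ` as a bounded bilinear operator on `ℓ²`. -/
def bilin : SeqL2 →L[ℝ] SeqL2 →L[ℝ] SeqL2 :=
  LinearMap.mkContinuous₂ (LinearMap.mk₂ ℝ hκ.kerSeq
    (fun b b' c => by
      ext k
      have h := (hκ.summable' b c k).tsum_add (hκ.summable' b' c k)
      refine Eq.trans (tsum_congr fun j => ?_) h
      simp only [lp.coeFn_add, Pi.add_apply]
      ring)
    (fun r b c => by
      ext k
      have h := (hκ.summable' b c k).tsum_mul_left (a := (r : ℂ))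
      simp only [kerSeq, kerSum, lp.coeFn_smul, Pi.smul_apply, Complex.real_smul]
      rw [← h]
      exact tsum_congr fun j => by ring)
    (fun b c c' => by
      ext k
      have h := (hκ.summable' b c k).tsum_add (hκ.summable' b c' k)
      refine Eq.trans (tsum_congr fun j => ?_) h
      simp only [lp.coeFn_add, Pi.add_apply]
      ring)
    (fun r b c => by
      ext k
      have h := (hκ.summable' b c k).tsum_mul_left (a := (r : ℂ))
      simp only [kerSeq, kerSum, lp.coeFn_smul, Pi.smul_apply, Complex.real_smul]
      rw [← h]
      exact tsum_congr fun j => by ring)) (√M) hκ.norm_kerSeq_le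

end RowBounded

section Diag

variable {d : ℤ → ℂ} {C : ℝ} (hd : ∀ k, ‖d k‖ ≤ C)
include hd

lemma summable_diag (b : SeqL2) : Summable fun k => ‖d k * b k‖ ^ 2 := by
  refine .of_nonneg_of_le (fun _ => sq_nonneg _) (fun k => ?_) (b.summable_norm_sq.mul_left (C ^ 2))
  rw [norm_mul, mul_pow]
  gcongr
  exact hd k

/-- Multiplication by a bounded sequence, as a bounded operator on `ℓ²`. -/
def diag : SeqL2 →L[ℝ] SeqL2 :=
  LinearMap.mkContinuous
    { toFun := fun b => ⟨fun k => d k * b k, (memlp_two_iff _).2 (summable_diag hd b)⟩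
      map_add' := fun b c => by ext k; exact mul_add _ _ _
      map_smul' := fun r b => by ext k; simp; ring } C (fun b => by
    have hC : 0 ≤ C := (norm_nonneg _).trans (hd 0)
    refine abs_le_of_sq_le_sq' ?_ (by positivity) |>.2
    rw [← SeqL2.tsum_norm_sq, mul_pow, ← SeqL2.tsum_norm_sq, ← tsum_mul_left]
    refine (summable_diag hd b).tsum_le_tsum (fun k => ?_) (b.summable_norm_sq.mul_left (C ^ 2))
    change ‖d k * b k‖ ^ 2 ≤ _
    rw [norm_mul, mul_pow]
    gcongr
    exact hd k)

lemma diag_apply (b : SeqL2) (k : ℤ) : diag hd b k = d k * b k := rfl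

end Diag

/-! ### The equation as an ordinary differential equation in `ℓ²`. -/

/-- The weight `(1 + k²)^(s/2)`. -/
def wt (s : ℝ) (k : ℤ) : ℝ := (1 + (k : ℝ) ^ 2) ^ (s / 2)

lemma wt_pos (s : ℝ) (k : ℤ) : 0 < wt s k := Real.rpow_pos_of_pos (by positivity) _

lemma wt_ne_zero (s : ℝ) (k : ℤ) : (wt s k : ℂ) ≠ 0 := by exact_mod_cast (wt_pos s k).ne'

lemma wt_neg (s : ℝ) (k : ℤ) : wt s (-k) = wt s k := by simp [wt]

lemma wt_sq (s : ℝ) (k : ℤ) : wt s k ^ 2 = (1 + (k : ℝ) ^ 2) ^ s := by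
  rw [wt, ← Real.rpow_natCast, ← Real.rpow_mul (by positivity)]
  norm_num

lemma weighted_eq (s : ℝ) (f : Circ → ℝ) (k : ℤ) : weighted s f k = wt s k * coeff f k := rfl

/-- The symbol `-ik / (1 + |k|)` of `-(1 + 𝓗 ∂ₓ)⁻¹ ∂ₓ`. -/
def theta (k : ℤ) : ℂ := -(Complex.I * k) / (1 + |(k : ℝ)| : ℝ)

lemma norm_theta_le (k : ℤ) : ‖theta k‖ ≤ 1 := by
  have h : 0 < 1 + |(k : ℝ)| := by positivity
  rw [theta, norm_div, Complex.norm_real, norm_neg, norm_mul, Complex.norm_I, one_mul,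
    Complex.norm_intCast, Real.norm_of_nonneg h.le, div_le_one h]
  linarith

open ComplexConjugate in
lemma theta_neg (k : ℤ) : theta (-k) = conj (theta k) := by
  simp [theta]

/-- The kernel of the quadratic part of the equation, for weighted Fourier coefficients. -/
def kap (s : ℝ) (k j : ℤ) : ℂ := theta k / 2 * (wt s k / (wt s j * wt s (k - j)) : ℝ)

lemma summable_wt_inv_sq {s : ℝ} (hs : 3 / 2 ≤ s) : Summable fun k : ℤ => (wt s k ^ 2)⁻¹ := by
  have h : Summable fun k : ℤ => 1 / |(k : ℝ) - 0| ^ (2 : ℝ) :=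
    by simpa using (Real.summable_one_div_int_add_rpow 0 2).2 (by norm_num)
  refine Summable.of_norm_bounded_eventually (g := fun k : ℤ => 1 / |(k : ℝ) - 0| ^ (2 : ℝ)) h ?_
  refine (Set.finite_singleton (0 : ℤ)).subset fun k hk => ?_
  by_contra hk0
  apply hk
  have hk1 : (1 : ℝ) ≤ (k : ℝ) ^ 2 := by
    have h0 : k ≠ 0 := hk0
    have : 0 < k ^ 2 := by positivity
    have : 1 ≤ k ^ 2 := by omega
    exact_mod_cast this
  change ‖(wt s k ^ 2)⁻¹‖ ≤ 1 / |(k : ℝ) - 0| ^ (2 : ℝ)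
  rw [Real.norm_of_nonneg (by positivity), wt_sq, sub_zero, Real.rpow_two, sq_abs, one_div]
  gcongr
  calc (k : ℝ) ^ 2 ≤ (1 + (k : ℝ) ^ 2) ^ (1 : ℝ) := by rw [Real.rpow_one]; linarith
    _ ≤ _ := Real.rpow_le_rpow_of_exponent_le (by linarith) (by linarith)

/-- A bound for the rows of `kap s`. -/
def kapBound (s : ℝ) : ℝ := 4 ^ s * (2 * ∑' k : ℤ, (wt s k ^ 2)⁻¹)

/-- One of the frequencies `j`, `k - j` carries the weight of `k`, since `1 + k² ≤ 4 max (1 + j²) (1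
+ (k - j)²)`. This is the algebra property of `H^s`: the other factor is left with a summable
inverse weight. -/
lemma wt_sq_le {s : ℝ} (hs : 3 / 2 ≤ s) (k j : ℤ) :
    wt s k ^ 2 ≤ 4 ^ s * (wt s j ^ 2 + wt s (k - j) ^ 2) := by
  simp only [wt_sq]
  set A : ℝ := 1 + (j : ℝ) ^ 2 with hA
  set B : ℝ := 1 + ((k - j : ℤ) : ℝ) ^ 2 with hB
  have hAp : 0 < A := by positivity
  have hBp : 0 < B := by positivity
  have hk : 1 + (k : ℝ) ^ 2 ≤ 2 * (A + B) := by
    rw [hA, hB]; push_cast; nlinarith [sq_nonneg ((k : ℝ) - 2 * j)]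
  have hs0 : 0 ≤ s := by linarith
  rcases le_total A B with h | h
  · calc (1 + (k : ℝ) ^ 2) ^ s ≤ (4 * B) ^ s := by
          apply Real.rpow_le_rpow (by positivity) (by linarith) hs0
      _ = 4 ^ s * B ^ s := Real.mul_rpow (by norm_num) hBp.le
      _ ≤ _ := by
        have := Real.rpow_nonneg hAp.le s
        gcongr; linarith
  · calc (1 + (k : ℝ) ^ 2) ^ s ≤ (4 * A) ^ s := by
          apply Real.rpow_le_rpow (by positivity) (by linarith) hs0
      _ = 4 ^ s * A ^ s := Real.mul_rpow (by norm_num) hAp.le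
      _ ≤ _ := by
        have := Real.rpow_nonneg hBp.le s
        gcongr; linarith

lemma norm_kap_sq_le {s : ℝ} (hs : 3 / 2 ≤ s) (k j : ℤ) :
    ‖kap s k j‖ ^ 2 ≤ 4 ^ s * ((wt s j ^ 2)⁻¹ + (wt s (k - j) ^ 2)⁻¹) := by
  have h1 := wt_pos s j
  have h2 := wt_pos s (k - j)
  have h3 := wt_pos s k
  have ht : ‖theta k / 2‖ ≤ 1 := by
    rw [norm_div]; have := norm_theta_le k; norm_num; linarith
  rw [kap, norm_mul, Complex.norm_real, Real.norm_of_nonneg (by positivity), mul_pow]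
  calc _ ≤ 1 ^ 2 * (wt s k / (wt s j * wt s (k - j))) ^ 2 := by gcongr
    _ = wt s k ^ 2 / (wt s j ^ 2 * wt s (k - j) ^ 2) := by ring
    _ ≤ (4 ^ s * (wt s j ^ 2 + wt s (k - j) ^ 2)) / (wt s j ^ 2 * wt s (k - j) ^ 2) := by
      gcongr; exact wt_sq_le hs k j
    _ = _ := by field_simp; ring

lemma rowBounded_kap {s : ℝ} (hs : 3 / 2 ≤ s) : RowBounded (kap s) (kapBound s) := by
  have h1 := summable_wt_inv_sq hs
  have h2 : ∀ k, HasSum (fun j => (wt s (k - j) ^ 2)⁻¹) (∑' k : ℤ, (wt s k ^ 2)⁻¹) := fun k =>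
    (Equiv.subLeft k).hasSum_iff (f := fun j => (wt s j ^ 2)⁻¹) |>.2 h1.hasSum
  have h3 := fun k => (h1.hasSum.add (h2 k)).mul_left (4 ^ s)
  have h4 := fun k => Summable.of_nonneg_of_le (fun _ => sq_nonneg _) (norm_kap_sq_le hs k)
    (h3 k).summable
  refine ⟨h4, fun k => ?_⟩
  refine ((h4 k).tsum_le_tsum (norm_kap_sq_le hs k) (h3 k).summable).trans (le_of_eq ?_)
  rw [(h3 k).tsum_eq, kapBound]
  ring

section Field

variable {s : ℝ} (hs : 3 / 2 ≤ s)

/-- The right-hand side of the equation `u_t = -(1 + 𝓗 ∂ₓ)⁻¹ ∂ₓ (u + u² / 2)`, for weighted Fourier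
coefficients. -/
def field (b : SeqL2) : SeqL2 := diag norm_theta_le b + (rowBounded_kap hs).bilin b b

lemma field_apply (b : SeqL2) (k : ℤ) :
    field hs b k = theta k * b k + ∑' j, kap s k j * (b j * b (k - j)) := rfl

lemma field_apply' (b : SeqL2) (k : ℤ) :
    field hs b k = wt s k * (theta k * (b k / wt s k +
      1 / 2 * ∑' j, (b j / wt s j) * (b (k - j) / wt s (k - j)))) := by
  have hk := wt_ne_zero s k
  rw [field_apply, mul_add, mul_add, ← tsum_mul_left, ← tsum_mul_left, ← tsum_mul_left]
  congr 1
  · field_simp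
  · refine tsum_congr fun j => ?_
    have hj := wt_ne_zero s j
    have hkj := wt_ne_zero s (k - j)
    rw [kap]
    push_cast
    field_simp

/-- Telescoping of the quadratic part: `B b b - B c c = B (b - c) b + B c (b - c)`. -/
lemma norm_field_sub_le {R : ℝ} {b c : SeqL2} (hb : ‖b‖ ≤ R) (hc : ‖c‖ ≤ R) :
    ‖field hs b - field hs c‖ ≤
      (‖diag norm_theta_le‖ + 2 * ‖(rowBounded_kap hs).bilin‖ * R) * ‖b - c‖ := by
  set A := diag norm_theta_le
  set B := (rowBounded_kap hs).bilin
  have h : field hs b - field hs c = A (b - c) + (B (b - c) b + B c (b - c)) := by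
    simp only [field, map_sub, sub_apply]
    abel
  have h1 := A.le_opNorm (b - c)
  have h2 := B.le_opNorm₂ (b - c) b
  have h3 := B.le_opNorm₂ c (b - c)
  have h2' : ‖B‖ * ‖b - c‖ * ‖b‖ ≤ ‖B‖ * ‖b - c‖ * R := by gcongr
  have h3' : ‖B‖ * ‖c‖ * ‖b - c‖ ≤ ‖B‖ * R * ‖b - c‖ := by gcongr
  rw [h]
  refine (norm_add_le _ _).trans ?_
  have := norm_add_le (B (b - c) b) (B c (b - c))
  linarith

lemma field_zero : field hs 0 = 0 := by simp [field]

lemma norm_field_le {R : ℝ} {b : SeqL2} (hb : ‖b‖ ≤ R) :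
    ‖field hs b‖ ≤ (‖diag norm_theta_le‖ + 2 * ‖(rowBounded_kap hs).bilin‖ * R) * R := by
  have hR : 0 ≤ R := (norm_nonneg _).trans hb
  have h := norm_field_sub_le hs hb (c := 0) (by simpa using hR)
  rw [field_zero, sub_zero, sub_zero] at h
  exact h.trans (by gcongr)

lemma continuous_field : Continuous (field hs) := by
  unfold field
  fun_prop

end Field

/-! ### The invariant subspace of real functions. -/

open ComplexConjugate in
/-- The sequences with the symmetry of the Fourier coefficients of a real function. -/
def symmSeq : Submodule ℝ SeqL2 where
  carrier := {b | ∀ k, b (-k) = conj (b k)}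
  zero_mem' := fun k => by simp
  add_mem' := fun {b c} hb hc k => by
    simp only [lp.coeFn_add, Pi.add_apply, map_add]
    rw [hb k, hc k]
  smul_mem' := fun r b hb k => by
    simp only [lp.coeFn_smul, Pi.smul_apply, Complex.real_smul, map_mul, Complex.conj_ofReal]
    rw [hb k]

open ComplexConjugate in
lemma mem_symmSeq {b : SeqL2} : b ∈ symmSeq ↔ ∀ k, b (-k) = conj (b k) := Iff.rfl

/-- Closedness makes the subspace complete, so the Picard–Lindelöf theorem applies inside it and the
trajectory stays real. -/
lemma isClosed_symmSeq : IsClosed (symmSeq : Set SeqL2) := by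
  have h : (symmSeq : Set SeqL2) = ⋂ k : ℤ, {b | b (-k) = starRingEnd ℂ (b k)} := by
    ext b; simp [mem_symmSeq]
  rw [h]
  refine isClosed_iInter fun k => isClosed_eq ?_ ?_
  · exact (lp.evalCLM ℝ (fun _ : ℤ => ℂ) 2 (-k)).continuous
  · exact Complex.continuous_conj.comp (lp.evalCLM ℝ (fun _ : ℤ => ℂ) 2 k).continuous

instance : CompleteSpace symmSeq := isClosed_symmSeq.completeSpace_coe

lemma field_mem_symmSeq {s : ℝ} (hs : 3 / 2 ≤ s) {b : SeqL2} (hb : b ∈ symmSeq) :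
    field hs b ∈ symmSeq := by
  intro k
  rw [field_apply, field_apply, map_add, map_mul, theta_neg, hb k, Complex.conj_tsum]
  congr 1
  rw [← (Equiv.neg ℤ).tsum_eq]
  refine tsum_congr fun j => ?_
  have h1 : -k - (Equiv.neg ℤ) j = -(k - j) := by simp; ring
  rw [h1, Equiv.neg_apply]
  simp only [map_mul, hb j, hb (k - j), kap, theta_neg, wt_neg, map_div₀, Complex.conj_ofReal,
    map_ofNat]
  congr 4
  rw [show -k - -j = -(k - j) by ring, wt_neg]

/-! ### Pointwise bounds for the symmetrized symbol. -/

/-- The odd symbol `x (1 + x²)^s / (1 + |x|)`. -/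
def sym (s x : ℝ) : ℝ := x * (1 + x ^ 2) ^ s / (1 + |x|)

lemma sym_neg (s x : ℝ) : sym s (-x) = -sym s x := by
  simp only [sym, abs_neg, even_two.neg_pow]; ring

/-- Bernoulli's inequality for `(P / Q) ^ s`. -/
lemma rpow_sub_rpow_le {s P Q : ℝ} (hs : 1 ≤ s) (hP : 0 ≤ P) (hQ : 0 < Q) :
    Q ^ s - P ^ s ≤ s * Q ^ (s - 1) * (Q - P) := by
  have h := one_add_mul_self_le_rpow_one_add (s := P / Q - 1) (by
    have : 0 ≤ P / Q := by positivity
    linarith) hs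
  rw [add_sub_cancel, Real.div_rpow hP hQ.le, le_div_iff₀ (Real.rpow_pos_of_pos hQ s)] at h
  rw [Real.rpow_sub_one hQ.ne']
  have : (1 + s * (P / Q - 1)) * Q ^ s = Q ^ s - s * (Q ^ s / Q) * (Q - P) := by
    field_simp; ring
  linarith

lemma sqrt_one_add_sq_le {q : ℝ} (hq : 0 ≤ q) : √(1 + q ^ 2) ≤ 1 + q := by
  rw [Real.sqrt_le_left (by positivity)]; nlinarith

lemma le_sqrt_one_add_sq (q : ℝ) : q ≤ √(1 + q ^ 2) :=
  Real.le_sqrt_of_sq_le (by linarith)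

lemma rpow_eq_mul_sqrt (s : ℝ) {Q : ℝ} (hQ : 0 < Q) : Q ^ s = Q ^ (s - 1 / 2) * √Q := by
  rw [Real.sqrt_eq_rpow, ← Real.rpow_add hQ]; congr 1; ring

/-- A mean value estimate for a symbol of order `2s`: the difference splits into the increment of `x
/ (1 + x)` times `Q ^ s` and that of the power, and each loses one order against `q - p`. -/
lemma abs_sym_sub_le {s p q : ℝ} (hs : 1 ≤ s) (hp : 0 ≤ p) (hpq : p ≤ q) :
    |sym s q - sym s p| ≤ (1 + 2 * s) * (q - p) * (1 + q ^ 2) ^ (s - 1 / 2) := by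
  have hq : 0 ≤ q := hp.trans hpq
  have hQ : 0 < 1 + q ^ 2 := by positivity
  have hP : 0 < 1 + p ^ 2 := by positivity
  set Q := 1 + q ^ 2 with hQd
  set P := 1 + p ^ 2 with hPd
  have hPQ : P ≤ Q := by rw [hQd, hPd]; gcongr
  have hd : P ^ s ≤ Q ^ s := Real.rpow_le_rpow hP.le hPQ (by linarith)
  have e : sym s q - sym s p =
      (q - p) * (Q ^ s / ((1 + p) * (1 + q))) + p / (1 + p) * (Q ^ s - P ^ s) := by
    rw [sym, sym, abs_of_nonneg hp, abs_of_nonneg hq]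
    field_simp
    ring
  have hR : 0 < Q ^ (s - 1 / 2) := Real.rpow_pos_of_pos hQ _
  have h1 : Q ^ s / ((1 + p) * (1 + q)) ≤ Q ^ (s - 1 / 2) := by
    rw [div_le_iff₀ (by positivity), rpow_eq_mul_sqrt s hQ]
    gcongr
    have := sqrt_one_add_sq_le hq
    nlinarith
  have h2 : Q ^ s - P ^ s ≤ s * Q ^ (s - 1 / 2) * (2 * (q - p)) := by
    have e2 : Q ^ (s - 1) * √Q = Q ^ (s - 1 / 2) := by
      rw [Real.sqrt_eq_rpow, ← Real.rpow_add hQ]; congr 1; ring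
    calc _ ≤ s * Q ^ (s - 1) * (Q - P) := rpow_sub_rpow_le hs hP.le hQ
      _ ≤ s * Q ^ (s - 1) * (√Q * (2 * (q - p))) := by
        gcongr
        have := le_sqrt_one_add_sq q
        rw [← hQd] at this
        calc Q - P = (q + p) * (q - p) := by rw [hQd, hPd]; ring
          _ ≤ (2 * √Q) * (q - p) := by
            apply mul_le_mul_of_nonneg_right (by linarith) (by linarith)
          _ = _ := by ring
      _ = _ := by rw [← e2]; ring
  have h3 : p / (1 + p) ≤ 1 := by rw [div_le_one (by positivity)]; linarith
  rw [e, abs_of_nonneg (by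
    have : 0 ≤ q - p := by linarith
    have : 0 ≤ Q ^ s - P ^ s := by linarith
    positivity)]
  have h4 : p / (1 + p) * (Q ^ s - P ^ s) ≤ 1 * (Q ^ s - P ^ s) :=
    mul_le_mul_of_nonneg_right h3 (by linarith)
  have h5 : (q - p) * (Q ^ s / ((1 + p) * (1 + q))) ≤ (q - p) * Q ^ (s - 1 / 2) :=
    mul_le_mul_of_nonneg_left h1 (by linarith)
  linarith

lemma abs_sym_le (s x : ℝ) : |sym s x| ≤ |x| * (1 + x ^ 2) ^ (s - 1 / 2) := by
  have hX : 0 < 1 + x ^ 2 := by positivity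
  rw [sym, abs_div, abs_mul, abs_of_pos (Real.rpow_pos_of_pos hX s),
    abs_of_pos (show 0 < 1 + |x| by positivity), div_le_iff₀ (by positivity),
    rpow_eq_mul_sqrt s hX]
  have := sqrt_one_add_sq_le (abs_nonneg x)
  rw [sq_abs] at this
  have := Real.rpow_pos_of_pos hX (s - 1 / 2)
  rw [mul_assoc]
  gcongr

/-- The constant in `abs_sym_add_le`. -/
def symConst (s : ℝ) : ℝ := 4 ^ s * (2 + 2 * s)

/-- The symmetrized symbol gains the smallest of the three frequencies. -/
lemma abs_sym_add_le {s x y z : ℝ} (hs : 1 ≤ s) (h0 : x + y + z = 0) (hxy : |x| ≤ |y|)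
    (hxz : |x| ≤ |z|) :
    |sym s x + sym s y + sym s z| ≤
      symConst s * (|x| * ((1 + z ^ 2) ^ (s / 2) * (1 + y ^ 2) ^ ((s - 1) / 2))) := by
  set m := max |y| |z| with hm
  have hm0 : 0 ≤ m := (abs_nonneg y).trans (le_max_left _ _)
  have hM : 0 < 1 + m ^ 2 := by positivity
  have key : |sym s y + sym s z| ≤ (1 + 2 * s) * |x| * (1 + m ^ 2) ^ (s - 1 / 2) := by
    -- If `y` and `z` have the same sign, then `|x| = |y| + |z| ≥ 2 |x|`, so `x = 0`. Otherwise
    -- oddness turns the sum into a difference at `|y|`, `|z|`, which are at distance at most `|x|`.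
    have h1 : |sym s y + sym s z| ≤ |sym s (|y|) - sym s (|z|)| ∨ x = 0 := by
      rcases le_total 0 y with hy | hy <;> rcases le_total 0 z with hz | hz
      · right; rw [abs_of_nonneg hy] at hxy; rw [abs_of_nonneg hz] at hxz
        have : |x| = y + z := by rw [show x = -(y + z) by linarith, abs_neg, abs_of_nonneg (by linarith)]
        linarith
      · left; rw [abs_of_nonneg hy, abs_of_nonpos hz, sym_neg, sub_neg_eq_add]
      · left; rw [abs_of_nonpos hy, abs_of_nonneg hz, sym_neg, ← abs_neg]
        apply le_of_eq; ring_nf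
      · right; rw [abs_of_nonpos hy] at hxy; rw [abs_of_nonpos hz] at hxz
        have : |x| = -y + -z := by rw [show x = (-y + -z) by linarith, abs_of_nonneg (by linarith)]
        linarith
    rcases h1 with h1 | h1
    · have h2 : |(|y| - |z|)| ≤ |x| := by
        have h := abs_abs_sub_abs_le y (-z)
        rwa [abs_neg, sub_neg_eq_add, show y + z = -x by linarith, abs_neg] at h
      refine h1.trans ?_
      have h5 : 0 ≤ 1 + 2 * s := by linarith
      rcases le_total |y| |z| with h | h
      · rw [abs_sub_comm]
        refine (abs_sym_sub_le hs (abs_nonneg y) h).trans ?_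
        rw [hm, max_eq_right h]
        have := (neg_abs_le (|y| - |z|))
        gcongr
        linarith
      · refine (abs_sym_sub_le hs (abs_nonneg z) h).trans ?_
        rw [hm, max_eq_left h]
        have := (le_abs_self (|y| - |z|))
        gcongr
        linarith
    · have : z = -y := by linarith
      rw [this, sym_neg, add_neg_cancel, abs_zero]
      have : 0 ≤ 1 + 2 * s := by linarith
      positivity
  have hxm : |x| ≤ m := hxy.trans (le_max_left _ _)
  have h6 : |sym s x| ≤ |x| * (1 + m ^ 2) ^ (s - 1 / 2) := by
    refine (abs_sym_le s x).trans ?_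
    gcongr ?_ * ?_
    have : x ^ 2 ≤ m ^ 2 := by rw [← sq_abs]; gcongr
    exact Real.rpow_le_rpow (by positivity) (by linarith) (by linarith)
  have h7 : |sym s x + sym s y + sym s z| ≤ (2 + 2 * s) * |x| * (1 + m ^ 2) ^ (s - 1 / 2) := by
    rw [add_assoc]
    refine (abs_add_le _ _).trans ?_
    linarith
  -- The two larger frequencies are comparable, so powers of `m` can be distributed between `y` and
  -- `z` as needed.
  have hmy : m ≤ 2 * |y| := max_le (by linarith [abs_nonneg y]) (by
    rw [show z = -(x + y) by linarith, abs_neg]; linarith [abs_add_le x y])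
  have hmz : m ≤ 2 * |z| := max_le (by
    rw [show y = -(x + z) by linarith, abs_neg]; linarith [abs_add_le x z])
      (by linarith [abs_nonneg z])
  have hMy : 1 + m ^ 2 ≤ 4 * (1 + y ^ 2) := by nlinarith [sq_abs y, abs_nonneg y]
  have hMz : 1 + m ^ 2 ≤ 4 * (1 + z ^ 2) := by nlinarith [sq_abs z, abs_nonneg z]
  have h8 : (1 + m ^ 2) ^ (s - 1 / 2) ≤
      4 ^ s * ((1 + z ^ 2) ^ (s / 2) * (1 + y ^ 2) ^ ((s - 1) / 2)) := by
    calc (1 + m ^ 2) ^ (s - 1 / 2) = (1 + m ^ 2) ^ (s / 2) * (1 + m ^ 2) ^ ((s - 1) / 2) := by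
          rw [← Real.rpow_add hM]; congr 1; ring
      _ ≤ (4 * (1 + z ^ 2)) ^ (s / 2) * (4 * (1 + y ^ 2)) ^ ((s - 1) / 2) := by
        apply mul_le_mul
        · exact Real.rpow_le_rpow hM.le hMz (by linarith)
        · exact Real.rpow_le_rpow hM.le hMy (by linarith)
        · positivity
        · positivity
      _ = 4 ^ (s - 1 / 2) * ((1 + z ^ 2) ^ (s / 2) * (1 + y ^ 2) ^ ((s - 1) / 2)) := by
        rw [Real.mul_rpow (by norm_num) (by positivity), Real.mul_rpow (by norm_num) (by positivity),
          show (s - 1 / 2) = s / 2 + (s - 1) / 2 by ring, Real.rpow_add (by norm_num)]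
        ring
      _ ≤ _ := by
        gcongr
        · norm_num
        · linarith
  refine h7.trans ?_
  calc _ ≤ (2 + 2 * s) * |x| * (4 ^ s * ((1 + z ^ 2) ^ (s / 2) * (1 + y ^ 2) ^ ((s - 1) / 2))) := by
        gcongr
    _ = _ := by rw [symConst]; ring

/-! ### The cubic form and the energy identity. -/

/-- The bijection `(a, c) ↦ (c, -(a + c))`, which permutes cyclically the three summands of
`a + c + e = 0`. -/
def rot : ℤ × ℤ ≃ ℤ × ℤ where
  toFun p := (p.2, -(p.1 + p.2))
  invFun p := (-(p.1 + p.2), p.1)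
  left_inv p := by ext <;> simp
  right_inv p := by ext <;> simp

lemma rot_apply (p : ℤ × ℤ) : rot p = (p.2, -(p.1 + p.2)) := rfl

/-- The cubic term `u a u c u e`, `a + c + e = 0`. -/
def cubic (u : ℤ → ℂ) (p : ℤ × ℤ) : ℂ := u p.1 * u p.2 * u (-(p.1 + p.2))

lemma cubic_rot (u : ℤ → ℂ) (p : ℤ × ℤ) : cubic u (rot p) = cubic u p := by
  simp only [cubic, rot_apply]
  rw [show -(p.2 + -(p.1 + p.2)) = p.1 by ring]
  ring

/-- Symmetrization of the cubic form with an odd symbol. -/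
lemma hasSum_symmetrized {u : ℤ → ℂ} {ν : ℤ → ℝ} (hν : ∀ k, ν (-k) = -ν k) {S : ℂ}
    (h : HasSum (fun p : ℤ × ℤ => (ν (p.1 + p.2) : ℂ) * cubic u p) S) :
    HasSum (fun p : ℤ × ℤ => ((ν p.1 + ν p.2 + ν (-(p.1 + p.2)) : ℝ) : ℂ) * cubic u p)
      (-(3 * S)) := by
  -- Oddness moves the symbol onto the third frequency `-(a + c)`; rotating twice then puts it onto
  -- each of the other two.
  have h1 : HasSum (fun p : ℤ × ℤ => (ν (-(p.1 + p.2)) : ℂ) * cubic u p) (-S) := by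
    refine h.neg.congr_fun ?_
    intro p
    rw [hν]; push_cast; ring
  have h2 := (rot.hasSum_iff).2 h1
  have h3 := (rot.hasSum_iff).2 h2
  have e : -(3 * S) = -S + -S + -S := by ring
  rw [e]
  refine ((h2.add h3).add h1).congr_fun ?_
  intro p
  simp only [Function.comp_apply, cubic_rot]
  simp only [rot_apply]
  rw [show -(p.2 + -(p.1 + p.2)) = p.1 by ring, show -(-(p.1 + p.2) + p.1) = p.2 by ring]
  push_cast
  ring

/-- Fourier coefficients from weighted Fourier coefficients. -/
def unwt (s : ℝ) (b : SeqL2) (k : ℤ) : ℂ := b k / wt s k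

lemma unwt_neg {s : ℝ} {b : SeqL2} (hb : b ∈ symmSeq) (k : ℤ) :
    unwt s b (-k) = starRingEnd ℂ (unwt s b k) := by
  rw [unwt, unwt, hb k, wt_neg, map_div₀, Complex.conj_ofReal]

section Energy

variable {s : ℝ} (hs : 3 / 2 ≤ s) {d : ℤ → ℝ} {C : ℝ} (hd : ∀ k, ‖(d k : ℂ)‖ ≤ C)

include hs hd in
-- Absolute convergence of the double series, which justifies the rearrangements used for
-- symmetrization; it follows from `xy ≤ x² + y²` and the row bounds of `kap`.
lemma summable_energy_kernel (b : SeqL2) :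
    Summable fun p : ℤ × ℤ => (d p.1 : ℂ) ^ 2 * starRingEnd ℂ (b p.1) *
      (kap s p.1 p.2 * (b p.2 * b (p.1 - p.2))) := by
  have hκ := rowBounded_kap hs
  have h1 : Summable fun p : ℤ × ℤ => ‖b p.1‖ ^ 2 * ‖kap s p.1 p.2‖ ^ 2 := by
    refine (summable_prod_of_nonneg fun p => by positivity).2
      ⟨fun k => (hκ.summable k).mul_left (‖b k‖ ^ 2), ?_⟩
    simp only [tsum_mul_left]
    have h0 : ∀ k, 0 ≤ ‖b k‖ ^ 2 * ∑' j, ‖kap s k j‖ ^ 2 := fun k =>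
      mul_nonneg (sq_nonneg _) (tsum_nonneg fun _ => sq_nonneg _)
    have h0' : ∀ k, ‖b k‖ ^ 2 * ∑' j, ‖kap s k j‖ ^ 2 ≤ ‖b k‖ ^ 2 * kapBound s := fun k =>
      mul_le_mul_of_nonneg_left (hκ.tsum_le k) (sq_nonneg _)
    exact Summable.of_nonneg_of_le h0 h0' (b.summable_norm_sq.mul_right (kapBound s))
  have h2 := (hasSum_conv_sq b b).summable
  refine .of_norm_bounded ((h1.add h2).mul_left (C ^ 2)) fun p => ?_
  simp only [norm_mul, norm_pow, RCLike.norm_conj]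
  have h3 : ‖b p.1‖ * ‖kap s p.1 p.2‖ * (‖b p.2‖ * ‖b (p.1 - p.2)‖) ≤
      ‖b p.1‖ ^ 2 * ‖kap s p.1 p.2‖ ^ 2 + ‖b p.2‖ ^ 2 * ‖b (p.1 - p.2)‖ ^ 2 := by
    nlinarith [sq_nonneg (‖b p.1‖ * ‖kap s p.1 p.2‖ - ‖b p.2‖ * ‖b (p.1 - p.2)‖),
      mul_nonneg (mul_nonneg (norm_nonneg (b p.1)) (norm_nonneg (kap s p.1 p.2)))
        (mul_nonneg (norm_nonneg (b p.2)) (norm_nonneg (b (p.1 - p.2))))]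
  have h4 : ‖(d p.1 : ℂ)‖ ^ 2 ≤ C ^ 2 := by gcongr; exact hd _
  calc _ = ‖(d p.1 : ℂ)‖ ^ 2 *
      (‖b p.1‖ * ‖kap s p.1 p.2‖ * (‖b p.2‖ * ‖b (p.1 - p.2)‖)) := by ring
    _ ≤ _ := by gcongr

/-- The rate of change of the quadratic energy `‖diag d b‖²` along the flow is given by a cubic
form. -/
lemma exists_energy_identity {b : SeqL2} (hb : b ∈ symmSeq) {ν : ℤ → ℝ}
    (hν : ∀ k, ν k = d k ^ 2 * wt s k ^ 2 * (k / (1 + |(k : ℝ)|))) :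
    ∃ S : ℂ, HasSum (fun p : ℤ × ℤ => (ν (p.1 + p.2) : ℂ) * cubic (unwt s b) p) S ∧
      inner ℝ (diag hd b) (diag hd (field hs b)) = (-(Complex.I / 2) * S).re := by
  have hsum := summable_energy_kernel hs hd b
  set G : ℤ × ℤ → ℂ := fun p => -(Complex.I / 2) * ((ν (p.1 + p.2) : ℂ) * cubic (unwt s b) p)
    with hG
  -- With `k = a + c`, reality of the function turns the conjugate at `k` into the coefficient at
  -- `-(a + c)`, the third factor of `cubic`.
  have hcomp : (fun p : ℤ × ℤ => (d p.1 : ℂ) ^ 2 * starRingEnd ℂ (b p.1) *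
      (kap s p.1 p.2 * (b p.2 * b (p.1 - p.2)))) = G ∘ convEquiv := by
    ext p
    have e1 : (convEquiv p).1 = p.2 := rfl
    have e2 : (convEquiv p).2 = p.1 - p.2 := rfl
    simp only [hG, Function.comp_apply, cubic, e1, e2, add_sub_cancel]
    rw [unwt_neg hb, hν]
    simp only [unwt, kap, theta, map_div₀, Complex.conj_ofReal]
    have h1 := wt_ne_zero s p.1
    have h2 := wt_ne_zero s p.2
    have h3 := wt_ne_zero s (p.1 - p.2)
    have h4 : ((1 + |(p.1 : ℝ)| : ℝ) : ℂ) ≠ 0 := by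
      have : (1 + |(p.1 : ℝ)| : ℝ) ≠ 0 := by positivity
      exact_mod_cast this
    push_cast at h4 ⊢
    field_simp
  have hGs : HasSum G (∑' p : ℤ × ℤ, (d p.1 : ℂ) ^ 2 * starRingEnd ℂ (b p.1) *
      (kap s p.1 p.2 * (b p.2 * b (p.1 - p.2)))) := by
    rw [← convEquiv.hasSum_iff, ← hcomp]
    exact hsum.hasSum
  have hI : -(Complex.I / 2) ≠ 0 := by simp
  set A := ∑' p : ℤ × ℤ, (d p.1 : ℂ) ^ 2 * starRingEnd ℂ (b p.1) *
      (kap s p.1 p.2 * (b p.2 * b (p.1 - p.2))) with hA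
  refine ⟨(-(Complex.I / 2))⁻¹ * A, ?_, ?_⟩
  · have := hGs.mul_left (-(Complex.I / 2))⁻¹
    simpa only [hG, inv_mul_cancel_left₀ hI] using this
  · rw [mul_inv_cancel_left₀ hI, hA, hsum.tsum_prod, Complex.re_tsum hsum.prod,
      lp.inner_eq_tsum]
    refine tsum_congr fun k => ?_
    dsimp only
    rw [tsum_mul_left, Complex.inner, diag_apply, diag_apply, field_apply]
    have e : starRingEnd ℂ ((d k : ℂ) * b k) * ((d k : ℂ) * (theta k * b k +
        ∑' j, kap s k j * (b j * b (k - j)))) = ((d k ^ 2 * ‖b k‖ ^ 2 : ℝ) : ℂ) * theta k +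
        (d k : ℂ) ^ 2 * starRingEnd ℂ (b k) * ∑' j, kap s k j * (b j * b (k - j)) := by
      push_cast
      rw [← Complex.conj_mul' (b k), map_mul, Complex.conj_ofReal]
      ring
    -- The linear part of the equation is skew, so only the cubic term survives.
    have ht : (theta k).re = 0 := by
      rw [theta, Complex.div_ofReal_re]
      simp
    rw [mul_comm, e, Complex.add_re, Complex.re_ofReal_mul, ht, mul_zero, zero_add]

end Energy

/-! ### The conserved energy and the energy estimate. -/

/-- The weight `(1 + |k|)^(1/2)` of the conserved energy, relative to `wt s`. -/
def lowWt (s : ℝ) (k : ℤ) : ℝ := √(1 + |(k : ℝ)|) / wt s k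

lemma one_add_abs_le_wt_sq {s : ℝ} (hs : 1 ≤ s) (k : ℤ) : 1 + |(k : ℝ)| ≤ 2 * wt s k ^ 2 := by
  have h1 : (1 + (k : ℝ) ^ 2) ^ (1 : ℝ) ≤ (1 + (k : ℝ) ^ 2) ^ s :=
    Real.rpow_le_rpow_of_exponent_le (by nlinarith [sq_nonneg (k : ℝ)]) hs
  rw [Real.rpow_one] at h1
  rw [wt_sq]
  nlinarith [sq_nonneg (|(k : ℝ)| - 1), sq_abs (k : ℝ)]

lemma lowWt_sq (s : ℝ) (k : ℤ) : lowWt s k ^ 2 = (1 + |(k : ℝ)|) / wt s k ^ 2 := by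
  rw [lowWt, div_pow, Real.sq_sqrt (by positivity)]

lemma lowWt_nonneg (s : ℝ) (k : ℤ) : 0 ≤ lowWt s k := by
  have := wt_pos s k
  unfold lowWt
  positivity

lemma norm_lowWt_le {s : ℝ} (hs : 3 / 2 ≤ s) (k : ℤ) : ‖(lowWt s k : ℂ)‖ ≤ 2 := by
  rw [Complex.norm_real, Real.norm_of_nonneg (lowWt_nonneg s k)]
  refine abs_le_of_sq_le_sq' ?_ (by norm_num) |>.2
  have := wt_pos s k
  rw [lowWt_sq, div_le_iff₀ (by positivity)]
  have := one_add_abs_le_wt_sq (by linarith : 1 ≤ s) k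
  nlinarith [sq_nonneg (wt s k)]

lemma norm_one_le (k : ℤ) : ‖(((fun _ => 1 : ℤ → ℝ) k : ℝ) : ℂ)‖ ≤ 1 := by simp

section

variable {s : ℝ} (hs : 3 / 2 ≤ s)

/-- The conserved energy `∑ₖ (1 + |k|) |û(k)|²`. -/
def lowEnergy (b : SeqL2) : ℝ := ‖diag (norm_lowWt_le hs) b‖ ^ 2

/-- For this weight the symbol is `ν(k) = k`, and its symmetrization `a + c - (a + c)` is zero. -/
lemma inner_low_field {b : SeqL2} (hb : b ∈ symmSeq) :
    inner ℝ (diag (norm_lowWt_le hs) b) (diag (norm_lowWt_le hs) (field hs b)) = 0 := by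
  obtain ⟨S, hS, h⟩ := exists_energy_identity hs (norm_lowWt_le hs) hb (ν := fun k => (k : ℝ))
    (fun k => by
      have := wt_pos s k
      have : (1 + |(k : ℝ)|) ≠ 0 := by positivity
      rw [lowWt_sq]
      field_simp)
  have h3 := hasSum_symmetrized (fun k => by push_cast; ring) hS
  have h0 : -(3 * S) = 0 := by
    refine h3.unique ?_
    convert (hasSum_zero (α := ℂ) (β := ℤ × ℤ)) using 2 with p
    push_cast
    ring
  have hS0 : S = 0 := by simpa using h0
  rw [h, hS0, mul_zero, Complex.zero_re]

/-- The sum of `|a| / (1 + c²)` over `|a| ≤ |c|` is at most `3`. -/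
lemma exists_hasSum_low (c : ℤ) :
    ∃ v ≤ 3, HasSum (fun a : ℤ => if |a| ≤ |c| then |(a : ℝ)| / (1 + (c : ℝ) ^ 2) else 0) v := by
  refine ⟨_, ?_, hasSum_sum_of_ne_finset_zero (s := Finset.Icc (-|c|) |c|) fun a ha => ?_⟩
  · have h1 : ∀ a ∈ Finset.Icc (-|c|) |c|,
        (if |a| ≤ |c| then |(a : ℝ)| / (1 + (c : ℝ) ^ 2) else 0) ≤
          |(c : ℝ)| / (1 + (c : ℝ) ^ 2) := by
      intro a ha
      have ha' : |a| ≤ |c| := abs_le.2 (Finset.mem_Icc.1 ha)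
      rw [if_pos ha']
      have : |(a : ℝ)| ≤ |(c : ℝ)| := by exact_mod_cast ha'
      gcongr
    refine (Finset.sum_le_card_nsmul _ _ _ h1).trans ?_
    rw [Int.card_Icc, nsmul_eq_mul]
    have h2 : ((|c| + 1 - -|c|).toNat : ℝ) = 2 * |(c : ℝ)| + 1 := by
      have : 0 ≤ |c| + 1 - -|c| := by have := abs_nonneg c; linarith
      have h : ((|c| + 1 - -|c|).toNat : ℤ) = |c| + 1 - -|c| := Int.toNat_of_nonneg this
      have h' : (((|c| + 1 - -|c|).toNat : ℤ) : ℝ) = ((|c| + 1 - -|c| : ℤ) : ℝ) := by rw [h]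
      push_cast at h'
      rw [h']; ring
    rw [h2, mul_div_assoc', div_le_iff₀ (by positivity)]
    nlinarith [sq_abs (c : ℝ), sq_nonneg (|(c : ℝ)| - 1)]
  · rw [if_neg]
    intro h
    exact ha (Finset.mem_Icc.2 (abs_le.1 h))

/-- The majorant of the cubic form in the region where the first frequency is the smallest. -/
def majorant (b : SeqL2) (p : ℤ × ℤ) : ℝ :=
  ‖diag (norm_lowWt_le hs) b p.1‖ ^ 2 * ‖b (-(p.1 + p.2))‖ ^ 2 +
    (if |p.1| ≤ |p.2| then |(p.1 : ℝ)| / (1 + (p.2 : ℝ) ^ 2) else 0) * ‖b p.2‖ ^ 2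

lemma majorant_nonneg (b : SeqL2) (p : ℤ × ℤ) : 0 ≤ majorant hs b p := by
  unfold majorant
  split_ifs <;> positivity

/-- The first term factors into a product in the variables `a` and `-(a + c)`; in the second, the
sum over `a` for fixed `c` is at most `3`. -/
lemma exists_hasSum_majorant (b : SeqL2) :
    ∃ v ≤ (lowEnergy hs b + 3) * ‖b‖ ^ 2, HasSum (majorant hs b) v := by
  set g := diag (norm_lowWt_le hs) b with hg
  have h1 : HasSum (fun p : ℤ × ℤ => ‖g p.1‖ ^ 2 * ‖b (-(p.1 + p.2))‖ ^ 2)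
      (lowEnergy hs b * ‖b‖ ^ 2) := by
    have h := b.hasSum_norm_sq.mul g.hasSum_norm_sq (b.summable_norm_sq.mul_of_nonneg
      g.summable_norm_sq (fun _ => sq_nonneg _) (fun _ => sq_nonneg _))
    rw [← rot.symm.hasSum_iff] at h
    rw [mul_comm (lowEnergy hs b)]
    refine h.congr_fun fun p => ?_
    rw [mul_comm]
    rfl
  choose v hv3 hv using exists_hasSum_low
  have hv0 : ∀ c, 0 ≤ v c := fun c => (hv c).nonneg fun a => by split_ifs <;> positivity
  set F : ℤ × ℤ → ℝ := fun p =>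
    (if |p.2| ≤ |p.1| then |(p.2 : ℝ)| / (1 + (p.1 : ℝ) ^ 2) else 0) * ‖b p.1‖ ^ 2 with hF
  have hle : ∀ c, v c * ‖b c‖ ^ 2 ≤ 3 * ‖b c‖ ^ 2 := fun c => by gcongr; exact hv3 c
  have hvs : Summable fun c => v c * ‖b c‖ ^ 2 :=
    Summable.of_nonneg_of_le (fun c => mul_nonneg (hv0 c) (sq_nonneg _)) hle
      (b.summable_norm_sq.mul_left 3)
  have hFc : ∀ c, HasSum (fun a => F (c, a)) (v c * ‖b c‖ ^ 2) := fun c => (hv c).mul_right _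
  have hFs : Summable F := by
    refine (summable_prod_of_nonneg fun p => ?_).2 ⟨fun c => (hFc c).summable, ?_⟩
    · simp only [hF, Pi.zero_apply]; split_ifs <;> positivity
    · simpa only [(hFc _).tsum_eq] using hvs
  have h2 := (Equiv.prodComm ℤ ℤ).hasSum_iff.2 hFs.hasSum
  refine ⟨_, ?_, h1.add h2⟩
  rw [add_mul]
  gcongr
  rw [hFs.tsum_prod]
  simp only [(hFc _).tsum_eq]
  refine (hvs.tsum_le_tsum hle (b.summable_norm_sq.mul_left 3)).trans ?_
  rw [tsum_mul_left, b.tsum_norm_sq]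

end

/-- `sym s` at the integers. -/
abbrev symZ (s : ℝ) (k : ℤ) : ℝ := sym s k

lemma symZ_neg (s : ℝ) (k : ℤ) : symZ s (-k) = -symZ s k := by
  simp only [symZ, Int.cast_neg, sym_neg]

section

variable {s : ℝ} (hs : 3 / 2 ≤ s)

lemma symbol_cubic_le_majorant (b : SeqL2) (p : ℤ × ℤ) (h1 : |p.1| ≤ |p.2|)
    (h2 : |p.1| ≤ |-(p.1 + p.2)|) :
    |symZ s p.1 + symZ s p.2 + symZ s (-(p.1 + p.2))| * ‖cubic (unwt s b) p‖ ≤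
      symConst s * majorant hs b p := by
  obtain ⟨a, c⟩ := p
  dsimp only at h1 h2 ⊢
  obtain ⟨e, he⟩ : ∃ e, e = -(a + c) := ⟨_, rfl⟩
  rw [← he] at h2 ⊢
  have h0 : (a : ℝ) + c + e = 0 := by rw [he]; push_cast; ring
  have h1' : |(a : ℝ)| ≤ |(c : ℝ)| := by exact_mod_cast h1
  have h2' : |(a : ℝ)| ≤ |(e : ℝ)| := by exact_mod_cast h2
  have hsym := abs_sym_add_le (by linarith : 1 ≤ s) h0 h1' h2'
  have hK : 0 ≤ symConst s := by
    have : 0 ≤ 2 + 2 * s := by linarith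
    unfold symConst; positivity
  set C : ℝ := 1 + (c : ℝ) ^ 2 with hC
  have hCp : 0 < C := by positivity
  have hwe := wt_pos s e
  have hwc := wt_pos s c
  have hwa := wt_pos s a
  have e1 : (1 + (e : ℝ) ^ 2) ^ (s / 2) = wt s e := rfl
  have e2 : C ^ ((s - 1) / 2) = wt s c / √C := by
    rw [wt, ← hC, Real.sqrt_eq_rpow, ← Real.rpow_sub hCp]; congr 1; ring
  rw [e1, e2] at hsym
  have hcub : ‖cubic (unwt s b) (a, c)‖ = ‖b a‖ / wt s a * (‖b c‖ / wt s c) * (‖b e‖ / wt s e) := by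
    simp only [cubic, ← he, unwt, norm_mul, norm_div, Complex.norm_real]
    rw [Real.norm_of_nonneg hwa.le, Real.norm_of_nonneg hwc.le, Real.norm_of_nonneg hwe.le]
  have hg : ‖diag (norm_lowWt_le hs) b a‖ ^ 2 = (1 + |(a : ℝ)|) * (‖b a‖ / wt s a) ^ 2 := by
    rw [diag_apply, norm_mul, Complex.norm_real, Real.norm_of_nonneg (lowWt_nonneg s a), mul_pow,
      lowWt_sq]
    ring
  have hmaj : majorant hs b (a, c) = (1 + |(a : ℝ)|) * (‖b a‖ / wt s a) ^ 2 * ‖b e‖ ^ 2 +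
      |(a : ℝ)| / C * ‖b c‖ ^ 2 := by
    simp only [majorant, ← he, hg, if_pos h1, hC]
  rw [hcub, hmaj]
  set α := ‖b a‖ / wt s a with hα
  have hα0 : 0 ≤ α := by positivity
  have hsC : √C ^ 2 = C := Real.sq_sqrt hCp.le
  have hsC0 : 0 < √C := Real.sqrt_pos.2 hCp
  calc _ ≤ symConst s * (|(a : ℝ)| * (wt s e * (wt s c / √C))) *
        (α * (‖b c‖ / wt s c) * (‖b e‖ / wt s e)) := by gcongr
    _ = symConst s * (|(a : ℝ)| * ((α * ‖b e‖) * (‖b c‖ / √C))) := by field_simp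
    -- The single factor `|a|` serves both squares: with `α²` it is bounded by the conserved energy
    -- density, and with `1 / C` it is summable over `|a| ≤ |c|`.
    _ ≤ symConst s * (|(a : ℝ)| * ((α * ‖b e‖) ^ 2 + (‖b c‖ / √C) ^ 2)) := by
      gcongr
      have : 0 ≤ α * ‖b e‖ := by positivity
      have : 0 ≤ ‖b c‖ / √C := by positivity
      nlinarith [sq_nonneg (α * ‖b e‖ - ‖b c‖ / √C)]
    _ = symConst s * (|(a : ℝ)| * α ^ 2 * ‖b e‖ ^ 2 + |(a : ℝ)| / C * ‖b c‖ ^ 2) := by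
      rw [div_pow, hsC]; ring
    _ ≤ _ := by
      gcongr
      linarith

/-- Some rotation brings the smallest of the three frequencies to the first place; the symmetrized
symbol and the cubic term do not change. -/
lemma symbol_cubic_le (b : SeqL2) (p : ℤ × ℤ) :
    |symZ s p.1 + symZ s p.2 + symZ s (-(p.1 + p.2))| * ‖cubic (unwt s b) p‖ ≤
      symConst s * (majorant hs b p + majorant hs b (rot p) + majorant hs b (rot (rot p))) := by
  have hK : 0 ≤ symConst s := by
    have : 0 ≤ 2 + 2 * s := by linarith
    unfold symConst; positivity
  have m0 := mul_nonneg hK (majorant_nonneg hs b p)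
  have m1 := mul_nonneg hK (majorant_nonneg hs b (rot p))
  have m2 := mul_nonneg hK (majorant_nonneg hs b (rot (rot p)))
  have r1 : -(p.2 + -(p.1 + p.2)) = p.1 := by ring
  have r2 : -(-(p.1 + p.2) + p.1) = p.2 := by ring
  have k0 := symbol_cubic_le_majorant hs b p
  have k1 := symbol_cubic_le_majorant hs b (rot p)
  have k2 := symbol_cubic_le_majorant hs b (rot (rot p))
  rw [cubic_rot] at k1
  rw [cubic_rot, cubic_rot] at k2
  simp only [rot_apply, r1, r2] at k1 k2 m1 m2 ⊢
  have c1 : symZ s p.2 + symZ s (-(p.1 + p.2)) + symZ s p.1 =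
    symZ s p.1 + symZ s p.2 + symZ s (-(p.1 + p.2)) := by ring
  have c2 : symZ s (-(p.1 + p.2)) + symZ s p.1 + symZ s p.2 =
    symZ s p.1 + symZ s p.2 + symZ s (-(p.1 + p.2)) := by ring
  rw [c1] at k1
  rw [c2] at k2
  rw [mul_add, mul_add]
  rcases le_total |p.1| |p.2| with h1 | h1
  · rcases le_total |p.1| |-(p.1 + p.2)| with h2 | h2
    · linarith [k0 h1 h2]
    · linarith [k2 h2 (h2.trans h1)]
  · rcases le_total |p.2| |-(p.1 + p.2)| with h2 | h2
    · linarith [k1 h2 h1]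
    · linarith [k2 (h2.trans h1) h2]

/-- The energy estimate: the top order norm grows at most at a rate governed by the conserved
energy. -/
lemma abs_inner_field_le {b : SeqL2} (hb : b ∈ symmSeq) :
    |inner ℝ b (field hs b)| ≤ symConst s * (lowEnergy hs b + 3) * ‖b‖ ^ 2 := by
  obtain ⟨S, hS, h⟩ := exists_energy_identity hs norm_one_le hb (ν := symZ s) (fun k => by
    rw [wt_sq]; simp only [symZ, sym]; ring)
  have hid : ∀ c : SeqL2, diag norm_one_le c = c := fun c => by
    ext k; rw [diag_apply]; simp
  rw [hid, hid] at h
  have h3 := hasSum_symmetrized (symZ_neg s) hS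
  obtain ⟨v, hv, hm⟩ := exists_hasSum_majorant hs b
  have hm1 := rot.hasSum_iff.2 hm
  have hm2 := rot.hasSum_iff.2 hm1
  have hK : 0 ≤ symConst s := by
    have : 0 ≤ 2 + 2 * s := by linarith
    unfold symConst; positivity
  have hb3 : ‖-(3 * S)‖ ≤ symConst s * (v + v + v) := by
    rw [← h3.tsum_eq]
    refine tsum_of_norm_bounded (((hm.add hm1).add hm2).mul_left (symConst s)) fun p => ?_
    rw [norm_mul, Complex.norm_real, Real.norm_eq_abs]
    exact symbol_cubic_le hs b p
  have hSn : ‖S‖ ≤ symConst s * v := by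
    rw [norm_neg, norm_mul] at hb3
    norm_num at hb3
    linarith
  rw [h]
  refine (Complex.abs_re_le_norm _).trans ?_
  rw [norm_mul, norm_neg, norm_div, Complex.norm_I]
  have : symConst s * v ≤ symConst s * ((lowEnergy hs b + 3) * ‖b‖ ^ 2) := by gcongr
  norm_num
  have := norm_nonneg S
  linarith

end

/-! ### A priori bounds, uniqueness and stability for the flow in `ℓ²`. -/

section Flow

variable {s : ℝ} (hs : 3 / 2 ≤ s)

/-- `b` solves `b' = χ(t) field b` on `I` within the real sequences. -/
def IsSeqSol (χ : ℝ → ℝ) (I : Set ℝ) (b : ℝ → SeqL2) : Prop :=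
  ∀ t ∈ I, b t ∈ symmSeq ∧ HasDerivWithinAt b (χ t • field hs (b t)) I t

/-- The exponential growth rate in the a priori estimate. -/
def rate (b : SeqL2) : ℝ := symConst s * (lowEnergy hs b + 3)

lemma symConst_pos {s : ℝ} (hs : 3 / 2 ≤ s) : 0 < symConst s := by
  have : 0 < 2 + 2 * s := by linarith
  unfold symConst
  positivity

lemma rate_nonneg (b : SeqL2) : 0 ≤ rate hs b := by
  have := symConst_pos hs
  unfold rate lowEnergy
  positivity

/-- A Lipschitz constant of `field` on the ball of radius `R`. -/
def lipConst (R : ℝ) : ℝ := ‖diag norm_theta_le‖ + 2 * ‖(rowBounded_kap hs).bilin‖ * R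

lemma hasDerivWithinAt_Ici {E : Type*} [NormedAddCommGroup E] [NormedSpace ℝ E] {f : ℝ → E}
    {f' : E} {T t : ℝ} (h : HasDerivWithinAt f f' (Icc 0 T) t) (ht : t ∈ Ico 0 T) :
    HasDerivWithinAt f f' (Ici t) t :=
  h.mono_of_mem_nhdsWithin (Icc_mem_nhdsGE_of_mem ht)

namespace IsSeqSol

variable {hs} {χ : ℝ → ℝ} {I : Set ℝ} {b c : ℝ → SeqL2}

lemma mono (h : IsSeqSol hs χ I b) {J : Set ℝ} (hJ : J ⊆ I) : IsSeqSol hs χ J b :=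
  fun t ht => ⟨(h t (hJ ht)).1, (h t (hJ ht)).2.mono hJ⟩

lemma continuousOn (h : IsSeqSol hs χ I b) : ContinuousOn b I :=
  fun t ht => (h t ht).2.continuousWithinAt

/-- Time reversal only changes the scalar factor `χ`, so estimates for positive times give those for
negative times. -/
lemma reflect (h : IsSeqSol hs χ I b) {J : Set ℝ} (hJ : MapsTo Neg.neg J I) :
    IsSeqSol hs (fun t => -χ (-t)) J (fun t => b (-t)) := by
  intro t ht
  refine ⟨(h _ (hJ ht)).1, ?_⟩
  have h1 := (h _ (hJ ht)).2.scomp t (hasDerivAt_neg t).hasDerivWithinAt hJ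
  have h2 : (-χ (-t)) • field hs (b (-t)) = (-1 : ℝ) • (χ (-t) • field hs (b (-t))) := by
    rw [smul_smul, neg_one_mul]
  rw [h2]
  exact h1

lemma lowEnergy_eq {T : ℝ} (h : IsSeqSol hs χ (Icc 0 T) b) {t : ℝ} (ht : t ∈ Icc 0 T) :
    lowEnergy hs (b t) = lowEnergy hs (b 0) := by
  set D := diag (norm_lowWt_le hs) with hD
  have hd : ∀ t ∈ Icc 0 T, HasDerivWithinAt (fun τ => lowEnergy hs (b τ)) 0 (Icc 0 T) t := by
    intro t ht
    have h1 : HasDerivWithinAt (fun τ => lowEnergy hs (b τ)) _ (Icc 0 T) t :=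
      (D.hasFDerivAt.comp_hasDerivWithinAt t (h t ht).2).norm_sq
    refine h1.congr_deriv ?_
    rw [Function.comp_apply, map_smul, inner_smul_right, inner_low_field hs (h t ht).1]
    simp
  exact constant_of_has_deriv_right_zero (fun t ht => (hd t ht).continuousWithinAt)
    (fun t ht => hasDerivWithinAt_Ici (hd t (Ico_subset_Icc_self ht)) ht) t ht

/-- Gronwall's inequality for `‖b‖²`; the rate is constant in time by conservation of `lowEnergy`.
The factor `χ` costs nothing because the energy estimate bounds the absolute value of the inner
product. -/
lemma norm_le_of_Icc {T : ℝ} (h : IsSeqSol hs χ (Icc 0 T) b) (hχ : ∀ t, |χ t| ≤ 1) {t : ℝ}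
    (ht : t ∈ Icc 0 T) : ‖b t‖ ≤ ‖b 0‖ * Real.exp (rate hs (b 0) * t) := by
  have hd : ∀ t ∈ Icc 0 T, HasDerivWithinAt (fun τ => ‖b τ‖ ^ 2)
      (2 * inner ℝ (b t) (χ t • field hs (b t))) (Icc 0 T) t := fun t ht => (h t ht).2.norm_sq
  have hb : ∀ t ∈ Ico 0 T, ‖2 * inner ℝ (b t) (χ t • field hs (b t))‖ ≤
      (2 * rate hs (b 0)) * ‖‖b t‖ ^ 2‖ + 0 := by
    intro t ht
    have ht' := Ico_subset_Icc_self ht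
    have h1 := abs_inner_field_le hs (h t ht').1
    rw [h.lowEnergy_eq ht'] at h1
    rw [inner_smul_right, Real.norm_eq_abs, abs_mul, abs_mul, abs_two, norm_pow, norm_norm,
      add_zero, mul_assoc]
    refine mul_le_mul_of_nonneg_left ?_ zero_le_two
    calc _ ≤ 1 * |inner ℝ (b t) (field hs (b t))| := by gcongr; exact hχ t
      _ ≤ _ := by rw [one_mul]; exact h1
  have hg := norm_le_gronwallBound_of_norm_deriv_right_le
    (fun t ht => (hd t ht).continuousWithinAt)
    (fun t ht => hasDerivWithinAt_Ici (hd t (Ico_subset_Icc_self ht)) ht) le_rfl hb t ht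
  rw [gronwallBound_ε0, sub_zero, norm_pow, norm_pow, norm_norm, norm_norm] at hg
  refine abs_le_of_sq_le_sq' ?_ (by positivity) |>.2
  rw [mul_pow, ← Real.exp_nat_mul]
  rwa [show ((2 : ℕ) : ℝ) * (rate hs (b 0) * t) = 2 * rate hs (b 0) * t by push_cast; ring]

lemma norm_le (h : IsSeqSol hs χ I b) (hχ : ∀ t, |χ t| ≤ 1) (hI : I.OrdConnected)
    (h0 : (0 : ℝ) ∈ I) {t : ℝ} (ht : t ∈ I) :
    ‖b t‖ ≤ ‖b 0‖ * Real.exp (rate hs (b 0) * |t|) := by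
  rcases le_total 0 t with h1 | h1
  · rw [abs_of_nonneg h1]
    exact (h.mono (hI.out h0 ht)).norm_le_of_Icc hχ (right_mem_Icc.2 h1)
  · rw [abs_of_nonpos h1]
    have hm : MapsTo Neg.neg (Icc 0 (-t)) I := fun τ hτ =>
      hI.out ht h0 ⟨by linarith [hτ.2], by linarith [hτ.1]⟩
    have := (h.reflect hm).norm_le_of_Icc (fun t => by rw [abs_neg]; exact hχ _) (t := -t)
      (right_mem_Icc.2 (by linarith))
    simpa using this

lemma dist_le_of_Icc {σ T R : ℝ} (hσ : |σ| ≤ 1) (hb : IsSeqSol hs (fun _ => σ) (Icc 0 T) b)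
    (hc : IsSeqSol hs (fun _ => σ) (Icc 0 T) c) (hbR : ∀ t ∈ Icc 0 T, ‖b t‖ ≤ R)
    (hcR : ∀ t ∈ Icc 0 T, ‖c t‖ ≤ R) (hR : 0 ≤ R) {t : ℝ} (ht : t ∈ Icc 0 T) :
    ‖b t - c t‖ ≤ ‖b 0 - c 0‖ * Real.exp (lipConst hs R * t) := by
  have hL : 0 ≤ lipConst hs R := by unfold lipConst; positivity
  have hlip : LipschitzOnWith ⟨lipConst hs R, hL⟩ (fun x => σ • field hs x)
      (Metric.closedBall 0 R) := by
    refine LipschitzOnWith.of_dist_le_mul fun x hx y hy => ?_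
    rw [mem_closedBall_zero_iff] at hx hy
    rw [dist_eq_norm, dist_eq_norm, ← smul_sub, norm_smul, Real.norm_eq_abs]
    calc _ ≤ 1 * ‖field hs x - field hs y‖ := by gcongr
      _ ≤ _ := by rw [one_mul]; exact norm_field_sub_le hs hx hy
  have := dist_le_of_trajectories_ODE_of_mem (v := fun _ x => σ • field hs x)
    (s := fun _ => Metric.closedBall 0 R) (fun _ _ => hlip) hb.continuousOn
    (fun t ht => hasDerivWithinAt_Ici (hb t (Ico_subset_Icc_self ht)).2 ht)
    (fun t ht => mem_closedBall_zero_iff.2 (hbR t (Ico_subset_Icc_self ht))) hc.continuousOn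
    (fun t ht => hasDerivWithinAt_Ici (hc t (Ico_subset_Icc_self ht)).2 ht)
    (fun t ht => mem_closedBall_zero_iff.2 (hcR t (Ico_subset_Icc_self ht))) le_rfl t ht
  rw [dist_eq_norm, dist_eq_norm, sub_zero] at this
  exact this

/-- Lipschitz dependence on the initial data. -/
lemma dist_le {R : ℝ} (hb : IsSeqSol hs (fun _ => 1) I b) (hc : IsSeqSol hs (fun _ => 1) I c)
    (hI : I.OrdConnected) (h0 : (0 : ℝ) ∈ I) (hbR : ∀ t ∈ I, ‖b t‖ ≤ R)
    (hcR : ∀ t ∈ I, ‖c t‖ ≤ R) {t : ℝ} (ht : t ∈ I) :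
    ‖b t - c t‖ ≤ ‖b 0 - c 0‖ * Real.exp (lipConst hs R * |t|) := by
  have hR : 0 ≤ R := (norm_nonneg _).trans (hbR 0 h0)
  rcases le_total 0 t with h1 | h1
  · rw [abs_of_nonneg h1]
    have hm := hI.out h0 ht
    exact dist_le_of_Icc (by simp) (hb.mono hm) (hc.mono hm) (fun τ hτ => hbR τ (hm hτ))
      (fun τ hτ => hcR τ (hm hτ)) hR (right_mem_Icc.2 h1)
  · rw [abs_of_nonpos h1]
    have hm : MapsTo Neg.neg (Icc 0 (-t)) I := fun τ hτ =>
      hI.out ht h0 ⟨by linarith [hτ.2], by linarith [hτ.1]⟩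
    have := dist_le_of_Icc (σ := -1) (by simp) (hb.reflect hm) (hc.reflect hm)
      (fun τ hτ => hbR _ (hm hτ)) (fun τ hτ => hcR _ (hm hτ)) hR (t := -t)
      (right_mem_Icc.2 (by linarith))
    simpa using this

lemma eqOn (hb : IsSeqSol hs (fun _ => 1) I b) (hc : IsSeqSol hs (fun _ => 1) I c)
    (hI : I.OrdConnected) (h0 : (0 : ℝ) ∈ I) (hbc : b 0 = c 0) : EqOn b c I := by
  intro t ht
  -- `I` may be unbounded; on the segment from `0` to `t` the a priori estimate gives one radius for
  -- both solutions.
  have hu : (uIcc 0 t).OrdConnected := ordConnected_uIcc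
  have hsub : uIcc 0 t ⊆ I := hI.uIcc_subset h0 ht
  have h0' : (0 : ℝ) ∈ uIcc 0 t := left_mem_uIcc
  have habs : ∀ τ ∈ uIcc 0 t, |τ| ≤ |t| := fun τ hτ => by
    simpa using abs_sub_left_of_mem_uIcc hτ
  have hR : ∀ τ ∈ uIcc 0 t, ∀ f, IsSeqSol hs (fun _ => 1) I f →
      ‖f τ‖ ≤ ‖f 0‖ * Real.exp (rate hs (f 0) * |t|) := by
    intro τ hτ f hf
    refine ((hf.mono hsub).norm_le (by simp) hu h0' hτ).trans ?_
    have := rate_nonneg hs (f 0)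
    gcongr ‖f 0‖ * Real.exp (_ * ?_)
    exact habs τ hτ
  have h := (hb.mono hsub).dist_le (hc.mono hsub) hu h0' (fun τ hτ => hR τ hτ b hb)
    (fun τ hτ => by rw [hbc]; exact hR τ hτ c hc) (right_mem_uIcc (a := 0))
  rw [hbc, sub_self, norm_zero, zero_mul] at h
  exact sub_eq_zero.1 (norm_le_zero_iff.1 h)

end IsSeqSol

/-! ### Global existence by truncation. -/

/-- A Lipschitz cutoff, equal to `1` up to `R` and to `0` from `R + 1` on. -/
def cutoff (R r : ℝ) : ℝ := max 0 (min 1 (R + 1 - r))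

lemma cutoff_nonneg (R r : ℝ) : 0 ≤ cutoff R r := le_max_left _ _

lemma cutoff_le_one (R r : ℝ) : cutoff R r ≤ 1 := max_le zero_le_one (min_le_left _ _)

lemma cutoff_eq_one {R r : ℝ} (h : r ≤ R) : cutoff R r = 1 := by
  rw [cutoff, min_eq_left (by linarith), max_eq_right zero_le_one]

lemma cutoff_eq_zero {R r : ℝ} (h : R + 1 ≤ r) : cutoff R r = 0 :=
  max_eq_left ((min_le_right _ _).trans (by linarith))

lemma abs_cutoff_sub_le (R r r' : ℝ) : |cutoff R r - cutoff R r'| ≤ |r - r'| := by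
  refine (abs_max_sub_max_le_max _ _ _ _).trans ?_
  rw [sub_self, abs_zero, max_eq_right (abs_nonneg _)]
  refine (abs_min_sub_min_le_max _ _ _ _).trans ?_
  rw [sub_self, abs_zero, max_eq_right (abs_nonneg _), abs_sub_comm r r']
  apply le_of_eq; congr 1; ring

/-- The truncated vector field. -/
def truncField (R : ℝ) (b : SeqL2) : SeqL2 := cutoff R ‖b‖ • field hs b

lemma norm_truncField_le {R : ℝ} (hR : 0 ≤ R) (b : SeqL2) :
    ‖truncField hs R b‖ ≤ lipConst hs (R + 1) * (R + 1) := by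
  rw [truncField, norm_smul, Real.norm_of_nonneg (cutoff_nonneg _ _)]
  rcases le_total ‖b‖ (R + 1) with h | h
  · calc _ ≤ 1 * ‖field hs b‖ := by gcongr; exact cutoff_le_one _ _
      _ ≤ _ := by rw [one_mul]; exact norm_field_le hs h
  · rw [cutoff_eq_zero h, zero_mul]
    unfold lipConst
    positivity

lemma norm_truncField_sub_le {R : ℝ} (hR : 0 ≤ R) (b c : SeqL2) :
    ‖truncField hs R b - truncField hs R c‖ ≤
      (lipConst hs (R + 1) * (R + 1) + lipConst hs (R + 1)) * ‖b - c‖ := by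
  have hL : 0 ≤ lipConst hs (R + 1) := by unfold lipConst; positivity
  -- One point in the ball suffices: the increment of the cutoff is multiplied by `field` at that
  -- point only, and the other term vanishes when `c` lies outside.
  have main : ∀ b c : SeqL2, ‖b‖ ≤ R + 1 → ‖truncField hs R b - truncField hs R c‖ ≤
      (lipConst hs (R + 1) * (R + 1) + lipConst hs (R + 1)) * ‖b - c‖ := by
    intro b c hb
    have e : truncField hs R b - truncField hs R c =
        (cutoff R ‖b‖ - cutoff R ‖c‖) • field hs b +
          cutoff R ‖c‖ • (field hs b - field hs c) := by
      simp only [truncField, sub_smul, smul_sub]; abel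
    have h1 : ‖(cutoff R ‖b‖ - cutoff R ‖c‖) • field hs b‖ ≤
        ‖b - c‖ * (lipConst hs (R + 1) * (R + 1)) := by
      rw [norm_smul, Real.norm_eq_abs]
      gcongr
      · exact (abs_cutoff_sub_le _ _ _).trans (abs_norm_sub_norm_le b c)
      · exact norm_field_le hs hb
    have h2 : ‖cutoff R ‖c‖ • (field hs b - field hs c)‖ ≤ lipConst hs (R + 1) * ‖b - c‖ := by
      rw [norm_smul, Real.norm_of_nonneg (cutoff_nonneg _ _)]
      rcases le_total ‖c‖ (R + 1) with hc | hc
      · calc _ ≤ 1 * ‖field hs b - field hs c‖ := by gcongr; exact cutoff_le_one _ _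
          _ ≤ _ := by rw [one_mul]; exact norm_field_sub_le hs hb hc
      · rw [cutoff_eq_zero hc, zero_mul]
        positivity
    rw [e]
    refine (norm_add_le _ _).trans ?_
    linarith
  rcases le_total ‖b‖ (R + 1) with hb | hb
  · exact main b c hb
  rcases le_total ‖c‖ (R + 1) with hc | hc
  · rw [norm_sub_rev, norm_sub_rev b]
    exact main c b hc
  · rw [truncField, truncField, cutoff_eq_zero hb, cutoff_eq_zero hc, zero_smul, zero_smul,
      sub_zero, norm_zero]
    positivity

lemma exists_isSeqSol_Icc {b₀ : SeqL2} (hb₀ : b₀ ∈ symmSeq) {T : ℝ} (hT : 0 < T) :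
    ∃ b : ℝ → SeqL2, b 0 = b₀ ∧ IsSeqSol hs (fun _ => 1) (Icc (-T) T) b := by
  -- The a priori bound at time `T`, so that the cutoff equals `1` along the whole trajectory.
  set R := ‖b₀‖ * Real.exp (rate hs b₀ * T) with hRdef
  have hR : 0 ≤ R := by positivity
  have hL : 0 ≤ lipConst hs (R + 1) := by unfold lipConst; positivity
  have hmem : ∀ x : symmSeq, truncField hs R (x : SeqL2) ∈ symmSeq := fun x =>
    symmSeq.smul_mem _ (field_mem_symmSeq hs x.2)
  set v : ℝ → symmSeq → symmSeq := fun _ x => ⟨truncField hs R x, hmem x⟩ with hv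
  set B : NNReal := ⟨lipConst hs (R + 1) * (R + 1), by positivity⟩ with hB
  set K : NNReal := ⟨lipConst hs (R + 1) * (R + 1) + lipConst hs (R + 1), by positivity⟩ with hK
  set t₀ : Icc (-T) T := ⟨0, by constructor <;> linarith⟩ with ht₀
  -- The truncated field is bounded by `B` and Lipschitz everywhere, so a ball of radius `B T` works
  -- for any `T`, however large.
  have hPL : IsPicardLindelof v t₀ (⟨b₀, hb₀⟩ : symmSeq) (B * ⟨T, hT.le⟩) 0 B K := by
    refine ⟨fun t _ => ?_, fun x _ => continuousOn_const, fun t _ x _ => ?_, ?_⟩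
    · refine LipschitzOnWith.of_dist_le_mul fun x _ y _ => ?_
      rw [dist_eq_norm, dist_eq_norm]
      exact norm_truncField_sub_le hs hR x y
    · exact norm_truncField_le hs hR x
    · have : max (T - (t₀ : ℝ)) ((t₀ : ℝ) - -T) = T := by simp [ht₀]
      rw [this, NNReal.coe_zero, sub_zero]
      exact le_rfl
  obtain ⟨α, hα0, hα⟩ := hPL.exists_eq_forall_mem_Icc_hasDerivWithinAt₀
  set b : ℝ → SeqL2 := fun t => (α t : SeqL2) with hbdef
  have hb0 : b 0 = b₀ := by
    have : α 0 = ⟨b₀, hb₀⟩ := hα0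
    simp only [hbdef, this]
  have hsol : IsSeqSol hs (fun t => cutoff R ‖b t‖) (Icc (-T) T) b := fun t ht =>
    ⟨(α t).2, symmSeq.subtypeL.hasFDerivAt.comp_hasDerivWithinAt t (hα t ht)⟩
  refine ⟨b, hb0, fun t ht => ⟨(hsol t ht).1, ?_⟩⟩
  have hle : ‖b t‖ ≤ R := by
    refine (hsol.norm_le (fun t => by
      rw [abs_of_nonneg (cutoff_nonneg _ _)]; exact cutoff_le_one _ _) ordConnected_Icc
      ⟨by linarith, hT.le⟩ ht).trans ?_
    rw [hb0, hRdef]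
    gcongr
    · exact rate_nonneg hs _
    · exact abs_le.2 ht
  have := (hsol t ht).2
  dsimp only at this
  rwa [cutoff_eq_one hle] at this

/-- Global existence for the equation on Fourier coefficients. -/
lemma exists_isSeqSol_univ {b₀ : SeqL2} (hb₀ : b₀ ∈ symmSeq) :
    ∃ b : ℝ → SeqL2, b 0 = b₀ ∧ IsSeqSol hs (fun _ => 1) univ b := by
  choose f hf0 hf using fun n : ℕ =>
    exists_isSeqSol_Icc hs hb₀ (T := (n : ℝ) + 1) (by positivity)
  have hsub : ∀ {m n : ℕ}, m ≤ n → Icc (-((m : ℝ) + 1)) (m + 1) ⊆ Icc (-((n : ℝ) + 1)) (n + 1) :=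
    fun h => by
      have : (_ : ℝ) ≤ _ := Nat.cast_le.2 h
      exact Icc_subset_Icc (by linarith) (by linarith)
  have hz : ∀ m : ℕ, (0 : ℝ) ∈ Icc (-((m : ℝ) + 1)) (m + 1) := fun m => by
    constructor <;> linarith [(Nat.cast_nonneg m : (0 : ℝ) ≤ m)]
  have hcons : ∀ {m n : ℕ}, m ≤ n → EqOn (f m) (f n) (Icc (-((m : ℝ) + 1)) (m + 1)) :=
    fun {m n} h => (hf m).eqOn ((hf n).mono (hsub h)) ordConnected_Icc (hz m)
      (by rw [hf0, hf0])
  have hmem : ∀ (n : ℕ) (t : ℝ), |t| < n + 1 → t ∈ Icc (-((n : ℝ) + 1)) (n + 1) :=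
    fun n t h => abs_le.1 h.le
  -- The solutions on growing intervals agree by uniqueness. The half-length `n + 1` keeps `t` in
  -- the interior, so the glued curve has a two-sided derivative.
  set b : ℝ → SeqL2 := fun t => f ⌈|t|⌉₊ t with hb
  have hbf : ∀ (n : ℕ) (t : ℝ), |t| < n + 1 → b t = f n t := by
    intro n t ht
    have h1 : |t| < (⌈|t|⌉₊ : ℝ) + 1 := (Nat.le_ceil _).trans_lt (lt_add_one _)
    rcases le_total ⌈|t|⌉₊ n with h | h
    · exact hcons h (hmem _ _ h1)
    · exact (hcons h (hmem _ _ ht)).symm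
  refine ⟨b, ?_, fun t _ => ?_⟩
  · rw [hbf 0 0 (by simp), hf0]
  · have h1 : |t| < (⌈|t|⌉₊ : ℝ) + 1 := (Nat.le_ceil _).trans_lt (lt_add_one _)
    have hnhds : ∀ᶠ τ in 𝓝 t, |τ| < (⌈|t|⌉₊ : ℝ) + 1 :=
      continuous_abs.continuousAt.eventually_lt continuousAt_const h1
    have hfs := hf ⌈|t|⌉₊ t (hmem _ _ h1)
    rw [hbf _ t h1]
    refine ⟨hfs.1, HasDerivAt.hasDerivWithinAt ?_⟩
    have hd : HasDerivAt (f ⌈|t|⌉₊) ((1 : ℝ) • field hs (f ⌈|t|⌉₊ t)) t :=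
      hfs.2.hasDerivAt (hnhds.mono fun τ hτ => hmem _ _ hτ)
    exact hd.congr_of_eventuallyEq (hnhds.mono fun τ hτ => hbf _ τ hτ)

/-! ### From coordinatewise to strong differentiability. -/

/-- A curve in `ℓ²` that is differentiable in every coordinate, with a derivative that is continuous
in `ℓ²`, is differentiable in `ℓ²`. -/
lemma hasDerivWithinAt_of_coord {I : Set ℝ} (hI : I.OrdConnected) {b g : ℝ → SeqL2}
    (hg : ContinuousOn g I)
    (hb : ∀ t ∈ I, ∀ k, HasDerivWithinAt (fun τ => b τ k) (g t k) I t) {t : ℝ} (ht : t ∈ I) :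
    HasDerivWithinAt b (g t) I t := by
  rw [hasDerivWithinAt_iff_isLittleO, Asymptotics.isLittleO_iff]
  intro ε hε
  obtain ⟨δ, hδ, hgδ⟩ := Metric.continuousWithinAt_iff.1 (hg t ht) ε hε
  filter_upwards [inter_mem_nhdsWithin I (Metric.ball_mem_nhds t hδ)] with t' ht'
  set w := b t' - b t - (t' - t) • g t with hw
  refine lp.norm_le_of_forall_sum_le (p := 2) (by norm_num) (by positivity) fun A => ?_
  simp only [ENNReal.toReal_ofNat, Real.rpow_two]
  -- Projection to finitely many coordinates: there the curve is differentiable in norm, and since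
  -- `P` is a contraction the mean value inequality gives a bound independent of `A`.
  let P : SeqL2 → SeqL2 := fun y => ∑ k ∈ A, lp.single 2 k (y k)
  have hP : ∀ y : SeqL2, ‖P y‖ ^ 2 = ∑ k ∈ A, ‖y k‖ ^ 2 := fun y => by
    have := lp.norm_sum_single (p := 2) (E := fun _ : ℤ => ℂ) (by norm_num) (fun k => y k) A
    simpa only [ENNReal.toReal_ofNat, Real.rpow_two] using this
  have hPle : ∀ y : SeqL2, ‖P y‖ ≤ ‖y‖ := fun y => by
    refine abs_le_of_sq_le_sq' ?_ (norm_nonneg _) |>.2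
    rw [hP, ← y.tsum_norm_sq]
    exact y.summable_norm_sq.sum_le_tsum A fun _ _ => sq_nonneg _
  have hPsub : ∀ x y : SeqL2, P (x - y) = P x - P y := fun x y => by
    simp only [P, lp.coeFn_sub, Pi.sub_apply, lp.single_sub, Finset.sum_sub_distrib]
  have hPsmul : ∀ (r : ℝ) (y : SeqL2), P (r • y) = r • P y := fun r y => by
    simp only [P, lp.coeFn_smul, Pi.smul_apply, lp.single_smul, Finset.smul_sum]
  have hPd : ∀ τ ∈ I, HasDerivWithinAt (fun τ => P (b τ)) (P (g τ)) I τ := fun τ hτ => by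
    refine HasDerivWithinAt.fun_sum fun k _ => ?_
    exact (lp.singleContinuousLinearMap ℝ (fun _ : ℤ => ℂ) 2 k).hasFDerivAt.comp_hasDerivWithinAt
      τ (hb τ hτ k)
  have hconv : Convex ℝ (I ∩ Metric.ball t δ) := hI.convex.inter (convex_ball t δ)
  have hmv := hconv.norm_image_sub_le_of_norm_hasDerivWithin_le
    (f := fun τ => P (b τ) - τ • P (g t)) (f' := fun τ => P (g τ) - (1 : ℝ) • P (g t)) (C := ε)
    (fun τ hτ => ((hPd τ hτ.1).mono inter_subset_left).sub
      ((hasDerivWithinAt_id τ _).smul_const (P (g t))))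
    (fun τ hτ => by
      rw [one_smul, ← hPsub]
      refine (hPle _).trans ?_
      rw [← dist_eq_norm]
      exact (hgδ hτ.1 hτ.2).le)
    ⟨ht, Metric.mem_ball_self hδ⟩ ht'
  have e : P w = P (b t') - t' • P (g t) - (P (b t) - t • P (g t)) := by
    rw [hw, hPsub, hPsub, hPsmul, sub_smul]; abel
  rw [← hP, e]
  gcongr

end Flow

/-! ### Transfer between `H^s_per` and `ℓ²`. -/

lemma Hs.toSeq_apply {s : ℝ} (f : Hs s) (k : ℤ) : f.toSeq k = wt s k * coeff f.fn k := rfl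

lemma Hs.toSeq_mem_symmSeq {s : ℝ} (f : Hs s) : f.toSeq ∈ symmSeq := fun k => by
  rw [toSeq_apply, toSeq_apply, coeff_neg, wt_neg, map_mul, Complex.conj_ofReal]

lemma Hs.toSeq_sub {s : ℝ} (f g : Hs s) : (f - g).toSeq = f.toSeq - g.toSeq := by
  have h := toSeq_add (f - g) g
  rw [sub_add_cancel] at h
  rw [h, add_sub_cancel_right]

lemma Hs.toSeq_injective {s : ℝ} : Function.Injective (Hs.toSeq (s := s)) := fun f g h =>
  sub_eq_zero.1 ((f - g).eq_zero_of_toSeq (by rw [toSeq_sub, h, sub_self]))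

lemma one_le_sqrt_two_pi : 1 ≤ √(2 * Real.pi) :=
  Real.one_le_sqrt.2 (by linarith [Real.pi_gt_three])

lemma Hs.norm_toSeq_le {s : ℝ} (f : Hs s) : ‖f.toSeq‖ ≤ ‖f‖ := by
  rw [norm_eq]
  exact le_mul_of_one_le_left (norm_nonneg _) one_le_sqrt_two_pi

lemma Hs.continuous_toSeq {s : ℝ} : Continuous (Hs.toSeq (s := s)) := by
  refine (LipschitzWith.of_dist_le_mul (K := 1) fun f g => ?_).continuous
  rw [dist_eq_norm, dist_eq_norm, ← toSeq_sub, NNReal.coe_one, one_mul]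
  exact norm_toSeq_le _

lemma Hs.exists_toSeq_eq {s : ℝ} (hs : 0 ≤ s) {b : SeqL2} (hb : b ∈ symmSeq) :
    ∃ f : Hs s, f.toSeq = b := by
  have hc : Memℓp (fun k => b k / wt s k) 2 := by
    refine (memlp_two_iff _).2 (.of_nonneg_of_le (fun _ => sq_nonneg _) (fun k => ?_)
      b.summable_norm_sq)
    have h1 : 1 ≤ wt s k := Real.one_le_rpow (by nlinarith [sq_nonneg (k : ℝ)]) (by linarith)
    rw [norm_div, Complex.norm_real, Real.norm_of_nonneg (wt_pos s k).le]
    gcongr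
    exact div_le_self (norm_nonneg _) h1
  obtain ⟨f, hf⟩ := exists_coeff_eq (fun k => b k / wt s k) hc fun k => by
    rw [hb k, wt_neg, map_div₀, Complex.conj_ofReal]
  have hw : weighted s f = b := by
    ext k
    rw [weighted_eq, hf, mul_div_cancel₀ _ (wt_ne_zero s k)]
  exact ⟨⟨f, (memHs_iff s f).2 (hw ▸ lp.memℓp b)⟩, Subtype.ext hw⟩

section

variable {s : ℝ} (hs : 3 / 2 ≤ s)

lemma field_toSeq (f : Hs s) (k : ℤ) :
    field hs f.toSeq k =
      wt s k * (theta k * (coeff f.fn k + coeff (fun x => f.fn x ^ 2 / 2) k)) := by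
  have h : ∀ j, f.toSeq j / wt s j = coeff f.fn j := fun j => by
    rw [Hs.toSeq_apply, mul_div_cancel_left₀ _ (wt_ne_zero s j)]
  rw [field_apply', coeff_sq_div_two]
  simp only [h]

/-- The equation, solved for the time derivative. -/
lemma equation_iff (ut a c : ℤ → ℂ) (k : ℤ) :
    ut k + dx a k + dx c k + hilbert (dx ut) k = 0 ↔ ut k = theta k * (a k + c k) := by
  have hk : (Int.sign k : ℂ) * k = ((|(k : ℝ)| : ℝ) : ℂ) := by
    have := Int.sign_mul_self_eq_abs k
    exact_mod_cast congrArg (fun n : ℤ => (n : ℂ)) this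
  have h1 : ((1 + |(k : ℝ)| : ℝ) : ℂ) ≠ 0 := by
    have : (1 + |(k : ℝ)| : ℝ) ≠ 0 := by positivity
    exact_mod_cast this
  have h2 : hilbert (dx ut) k = ((|(k : ℝ)| : ℝ) : ℂ) * ut k := by
    rw [← hk, hilbert, dx]
    linear_combination (-(Int.sign k : ℂ) * k * ut k) * Complex.I_mul_I
  rw [h2, theta, div_mul_eq_mul_div, eq_div_iff h1, dx, dx]
  push_cast
  constructor <;> intro h <;> linear_combination h

/-- Continuity in `H^s` makes `field` continuous along the solution, which upgrades the derivative
of each Fourier coefficient to a derivative in `ℓ²`. -/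
lemma IsSolution.isSeqSol {I : Set ℝ} (hI : I.OrdConnected) {u₀ : Hs s} {u : ℝ → Hs s}
    (h : IsSolution s I u₀ u) : IsSeqSol hs (fun _ => 1) I (fun t => (u t).toSeq) := by
  intro t ht
  refine ⟨(u t).toSeq_mem_symmSeq, ?_⟩
  rw [one_smul]
  refine hasDerivWithinAt_of_coord hI (g := fun t => field hs (u t).toSeq)
    ((continuous_field hs).comp_continuousOn
      (Hs.continuous_toSeq.comp_continuousOn h.continuousOn)) (fun t ht k => ?_) ht
  obtain ⟨ut, hut, heq⟩ := h.equation t ht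
  rw [field_toSeq, ← (equation_iff ut _ _ k).1 (heq k)]
  exact (hut k).const_mul _

lemma isSolution_of_isSeqSol {I : Set ℝ} {u₀ : Hs s} {u : ℝ → Hs s} (h0 : u 0 = u₀)
    (h : IsSeqSol hs (fun _ => 1) I (fun t => (u t).toSeq)) : IsSolution s I u₀ u := by
  refine ⟨fun t ht => ?_, h0, fun t ht => ?_⟩
  · have hc := (h t ht).2.continuousWithinAt
    rw [ContinuousWithinAt, tendsto_iff_norm_sub_tendsto_zero] at hc ⊢
    have := hc.const_mul √(2 * Real.pi)
    simpa only [Hs.norm_eq, Hs.toSeq_sub, mul_zero] using this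
  · obtain ⟨ut, hut⟩ : ∃ ut : ℤ → ℂ, ∀ k,
        ut k = theta k * (coeff (u t).fn k + coeff (fun x => (u t).fn x ^ 2 / 2) k) :=
      ⟨_, fun _ => rfl⟩
    refine ⟨ut, fun k => ?_, fun k => (equation_iff ut _ _ k).2 (hut k)⟩
    have hd := (h t ht).2
    rw [one_smul] at hd
    have hk := (lp.evalCLM ℝ (fun _ : ℤ => ℂ) 2 k).hasFDerivAt.comp_hasDerivWithinAt t hd
    have hk' : HasDerivWithinAt (fun τ => (wt s k : ℂ) * coeff (u τ).fn k)
        (wt s k * ut k) I t := by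
      rw [hut, ← field_toSeq hs]
      exact hk
    have := hk'.const_mul (wt s k : ℂ)⁻¹
    simpa only [inv_mul_cancel_left₀ (wt_ne_zero s k)] using this

/-- The conserved energy is of `H^{1/2}` type, hence dominated by the `H^{3/2}` norm: `1 + |k| ≤ 2
(1 + k²)^(3/2)`, and the `2` is absorbed by the `2π` in the norm. -/
lemma lowEnergy_toSeq_le (f : Hs s) : lowEnergy hs f.toSeq ≤ hsNorm (3 / 2) f.fn ^ 2 := by
  have hle : ∀ k : ℤ, (1 + (k : ℝ) ^ 2) ^ (3 / 2 : ℝ) * ‖coeff f.fn k‖ ^ 2 ≤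
      (1 + (k : ℝ) ^ 2) ^ s * ‖coeff f.fn k‖ ^ 2 := fun k => by
    gcongr
    nlinarith [sq_nonneg (k : ℝ)]
  have hsum : Summable fun k : ℤ => (1 + (k : ℝ) ^ 2) ^ (3 / 2 : ℝ) * ‖coeff f.fn k‖ ^ 2 :=
    .of_nonneg_of_le (fun k => by positivity) hle f.2
  have h0 : 0 ≤ ∑' k : ℤ, (1 + (k : ℝ) ^ 2) ^ (3 / 2 : ℝ) * ‖coeff f.fn k‖ ^ 2 :=
    tsum_nonneg fun k => by positivity
  have hterm : ∀ k, ‖diag (norm_lowWt_le hs) f.toSeq k‖ ^ 2 ≤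
      2 * ((1 + (k : ℝ) ^ 2) ^ (3 / 2 : ℝ) * ‖coeff f.fn k‖ ^ 2) := fun k => by
    have hw := wt_pos s k
    have h1 := one_add_abs_le_wt_sq (s := 3 / 2) (by norm_num) k
    rw [wt_sq] at h1
    have e : ‖diag (norm_lowWt_le hs) f.toSeq k‖ ^ 2 = (1 + |(k : ℝ)|) * ‖coeff f.fn k‖ ^ 2 := by
      rw [diag_apply, Hs.toSeq_apply, norm_mul, norm_mul, Complex.norm_real, Complex.norm_real,
        Real.norm_of_nonneg (lowWt_nonneg s k), Real.norm_of_nonneg hw.le, mul_pow, mul_pow,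
        lowWt_sq]
      field_simp
    rw [e, ← mul_assoc]
    gcongr
  rw [hsNorm, Real.sq_sqrt (by positivity), lowEnergy, ← SeqL2.tsum_norm_sq]
  refine ((SeqL2.summable_norm_sq _).tsum_le_tsum hterm (hsum.mul_left 2)).trans ?_
  rw [tsum_mul_left]
  gcongr
  linarith [Real.pi_gt_three]

lemma Hs.norm_le_of_isSeqSol {I : Set ℝ} (hI : I.OrdConnected) (h0 : (0 : ℝ) ∈ I)
    {u : ℝ → Hs s} (h : IsSeqSol hs (fun _ => 1) I (fun t => (u t).toSeq)) {t : ℝ} (ht : t ∈ I) :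
    ‖u t‖ ≤ ‖u 0‖ * Real.exp (symConst s * (hsNorm (3 / 2) (u 0).fn ^ 2 + 3) * |t|) := by
  have h1 := h.norm_le (by simp) hI h0 ht
  have hK := symConst_pos hs
  have h2 := lowEnergy_toSeq_le hs (u 0)
  rw [Hs.norm_eq, Hs.norm_eq, mul_assoc]
  gcongr
  refine h1.trans ?_
  rw [rate]
  gcongr

end

lemma globallyWellPosed {s : ℝ} (hs : 3 / 2 ≤ s) : GloballyWellPosed s := by
  have hex : ∀ u₀ : Hs s, ∃ u : ℝ → Hs s, u 0 = u₀ ∧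
      IsSeqSol hs (fun _ => 1) univ (fun t => (u t).toSeq) := fun u₀ => by
    obtain ⟨b, hb0, hb⟩ := exists_isSeqSol_univ hs u₀.toSeq_mem_symmSeq
    choose u hu using fun t => Hs.exists_toSeq_eq (s := s) (by linarith) (hb t (mem_univ t)).1
    refine ⟨u, Hs.toSeq_injective (by rw [hu, hb0]), ?_⟩
    simpa only [hu] using hb
  choose S hS0 hS using hex
  refine ⟨S, fun u₀ => isSolution_of_isSeqSol hs (hS0 u₀) (hS u₀), ?_, ?_⟩
  · intro I hI h0 u₀ u hu t ht
    have h := (hu.isSeqSol hs hI).eqOn ((hS u₀).mono (subset_univ I)) hI h0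
      (by simp only [hu.initial, hS0])
    exact Hs.toSeq_injective (h ht)
  · intro u₀ T hT
    have h0 : (0 : ℝ) ∈ Icc (-T) T := ⟨by linarith, hT.le⟩
    set N := ‖u₀‖ + 1 with hN
    set D := diag (norm_lowWt_le hs) with hD
    -- A common bound on `[-T, T]` for all solutions with data in the unit ball around `u₀`, whose
    -- norms are at most `N`; the Lipschitz constant depends only on this bound and `T`.
    set R := N * Real.exp (symConst s * ((‖D‖ * N) ^ 2 + 3) * T) with hR
    have hK := symConst_pos hs
    have hN0 : 0 ≤ N := by positivity
    have hR0 : 0 ≤ R := by positivity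
    have hb : ∀ v ∈ Metric.ball u₀ 1, ∀ t ∈ Icc (-T) T, ‖(S v t).toSeq‖ ≤ R := by
      intro v hv t ht
      have hvN : ‖v.toSeq‖ ≤ N := by
        have h1 : ‖v - u₀‖ < 1 := by rwa [← dist_eq_norm]
        have h2 := norm_sub_norm_le v u₀
        exact v.norm_toSeq_le.trans (by linarith)
      have hl : lowEnergy hs v.toSeq ≤ (‖D‖ * N) ^ 2 := by
        rw [lowEnergy]
        gcongr
        exact (D.le_opNorm _).trans (by gcongr)
      have h1 := ((hS v).mono (subset_univ (Icc (-T) T))).norm_le (by simp) ordConnected_Icc h0 ht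
      simp only [hS0] at h1
      refine h1.trans ?_
      have ht' : |t| ≤ T := abs_le.2 ht
      rw [rate, hR]
      gcongr
    refine ⟨Metric.ball u₀ 1, Metric.ball_mem_nhds u₀ one_pos,
      Real.exp (lipConst hs R * T), fun v hv w hw t ht => ?_⟩
    have h1 := ((hS v).mono (subset_univ (Icc (-T) T))).dist_le ((hS w).mono (subset_univ _))
      ordConnected_Icc h0 (hb v hv) (hb w hw) ht
    simp only [hS0] at h1
    rw [← Hs.toSeq_sub, ← Hs.toSeq_sub] at h1
    have ht' : |t| ≤ T := abs_le.2 ht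
    have hL : 0 ≤ lipConst hs R := by unfold lipConst; positivity
    rw [Hs.norm_eq, Hs.norm_eq, mul_left_comm, mul_comm (Real.exp _)]
    gcongr
    refine h1.trans ?_
    gcongr

end RBO

end

theorem mainTheorem10 (s : ℝ) (hs : 3 / 2 ≤ s) :
    (∃ C Cs : ℝ → ℝ, (∀ r, 0 < C r) ∧ (∀ r, 0 < Cs r) ∧
      ∀ T : ℝ, 0 < T → ∀ (u₀ : RBO.Hs s) (u : ℝ → RBO.Hs s),
        RBO.IsSolution s (Set.Icc 0 T) u₀ u →
        ∀ t ∈ Set.Icc 0 T,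
          ‖u t‖ ≤ Cs ‖u₀‖ * Real.exp (C (RBO.hsNorm (3 / 2) u₀.fn) * T)) ∧
    RBO.GloballyWellPosed s := by
  have hK := RBO.symConst_pos hs
  -- The bound `‖u₀‖` itself would do for `C_s`; `|r| + 1` is positive for every real `r`.
  refine ⟨⟨fun r => RBO.symConst s * (r ^ 2 + 3), fun r => |r| + 1, fun r => by positivity,
    fun r => by positivity, ?_⟩, RBO.globallyWellPosed hs⟩
  intro T hT u₀ u hu t ht
  have h := RBO.Hs.norm_le_of_isSeqSol hs Set.ordConnected_Icc (Set.left_mem_Icc.2 hT.le)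
    (hu.isSeqSol hs Set.ordConnected_Icc) ht
  rw [hu.initial, abs_of_nonneg ht.1] at h
  refine h.trans ?_
  have h1 : ‖u₀‖ ≤ |‖u₀‖| + 1 := by linarith [le_abs_self ‖u₀‖]
  gcongr
  exact ht.2
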